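/- An instance of Restricted Strip Cover consists of $n\ge 1$ sensors $s_1,\dots,s_n$. Sensor $s$ is live on a semi-closed interval $R(s)=[\ell(s),r(s))\subset\mathbb R$, where $\ell(s)<r(s)$ are non-negative integers, and it has a duration $d(s)$, a positive integer. Let $U=\bigcup_s R(s)$. A (non-preemptive) schedule assigns to each sensor $s$ one start time $t(s)\ge 0$. It has duration (at least) $T\ge 0$ if for all $x\in U$ and $0\le y<T$ there is a sensor $s$ with $x\in R(s)$ and $t(s)\le y<t(s)+d(s)$. Let $\mathit{OPT}$ be the largest duration of a schedule, and let $$L=\min_{x\in U}\ \sum_{s:\,x\in R(s)} d(s)$$ be the load of the instance. **Theorem.** There is a polynomial-time $O(\log\log n)$-approximation algorithm for Restricted Strip Cover, and its approximation ratio is with respect to the load $L$. That is, there are an algorithm and a function $\rho:\mathbb N\to\mathbb R$ with $\rho(n)=O(\log\log n)$ as $n\to\infty$ such that on every instance with $n\ge 1$ sensors the algorithm halts within a number of steps polynomial in the length of the input (the total number of binary digits of the integers $\ell(s),r(s),d(s)$), and it outputs a schedule of some duration $T$ with $$L\le \rho(n)\,T\qquad\text{and}\qquad \mathit{OPT}\le\rho(n)\,T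 .$$ Algorithms are programs for a random access machine that holds natural numbers in registers and arrays and whose operations, each of which costs one step, are constants, reading and writing registers and array entries, addition, truncated subtraction, and branching or looping on whether a value is nonzero. -/

import Mathlib

open Filter Asymptotics

/-! ## Restricted Strip Cover -/

namespace RSC

/-- A sensor: it is live on the semi-closed interval `[left, right)` and can be active for
`dur` consecutive time units. -/
structure Sensor where
  left : ℕ
  right : ℕ
  dur : ℕ
  left_lt_right : left < right
  dur_pos : 0 < dur

/-- The set of points at which a sensor is live. -/
def Sensor.region (s : Sensor) : Set ℝ := Set.Ico (s.left : ℝ) (s.right : ℝ)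

variable {n : ℕ}

/-- The region `U` to be covered: the union of the regions of the `n` sensors. -/
def region (S : Fin n → Sensor) : Set ℝ := ⋃ i, (S i).region

open Classical in
/-- The load at `x`: the total duration of the sensors that are live at `x`. -/
noncomputable def loadAt (S : Fin n → Sensor) (x : ℝ) : ℕ :=
  ∑ i with x ∈ (S i).region, (S i).dur

/-- The load `L`: the minimum over `x ∈ U` of the load at `x`. -/
noncomputable def load (S : Fin n → Sensor) : ℕ := sInf (loadAt S '' region S)

/-- `t` is a (non-preemptive) schedule that keeps `U` covered during `[0, T)`: sensor `i` is
activated once, at time `t i ≥ 0`, and is then active during `[t i, t i + dur)`. -/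
structure IsSchedule (S : Fin n → Sensor) (t : Fin n → ℝ) (T : ℝ) : Prop where
  start_nonneg : ∀ i, 0 ≤ t i
  dur_nonneg : 0 ≤ T
  covers : ∀ x ∈ region S, ∀ y : ℝ, 0 ≤ y → y < T →
    ∃ i, x ∈ (S i).region ∧ t i ≤ y ∧ y < t i + (S i).dur

/-- The length of the input: the total number of binary digits of its integers. -/
def inputSize (S : Fin n → Sensor) : ℕ :=
  ∑ i, (Nat.size (S i).left + Nat.size (S i).right + Nat.size (S i).dur)

end RSC

/-! ## Random access machine programs with a step count

Programs act on integer registers and integer arrays (random access memory). The only arithmetic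
operations are addition and truncated subtraction, and every operation costs one step. As there is
no multiplication, one step increases the bit length of the largest stored number by at most one
(up to the constants in the program), so polynomial time on this machine, measured in the bit
length of the input, is polynomial time on Turing machines. -/

namespace RAM

/-- Expressions: constants, registers, array entries, sums and truncated differences. -/
inductive Exp where
  | lit (c : ℕ)
  | var (r : ℕ)
  | get (a : ℕ) (idx : Exp)
  | add (e f : Exp)
  | sub (e f : Exp)

/-- Programs. Tests succeed when the value of the tested expression is nonzero. -/
inductive Prog where
  | skip
  | assign (r : ℕ) (e : Exp)
  | store (a : ℕ) (idx e : Exp)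
  | seq (p q : Prog)
  | ite (e : Exp) (p q : Prog)
  | loop (e : Exp) (p : Prog)

/-- The content of the registers and of the arrays. -/
structure State where
  reg : ℕ → ℕ
  arr : ℕ → ℕ → ℕ

/-- The value of an expression. -/
def Exp.val (σ : State) : Exp → ℕ
  | lit c => c
  | var r => σ.reg r
  | get a idx => σ.arr a (idx.val σ)
  | add e f => e.val σ + f.val σ
  | sub e f => e.val σ - f.val σ

/-- The number of steps to evaluate an expression: one for each operation and operand. -/
def Exp.cost : Exp → ℕ
  | lit _ => 1
  | var _ => 1
  | get _ idx => idx.cost + 1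
  | add e f => e.cost + f.cost + 1
  | sub e f => e.cost + f.cost + 1

/-- Write `v` into register `r`. -/
def State.setReg (σ : State) (r v : ℕ) : State :=
  { σ with reg := Function.update σ.reg r v }

/-- Write `v` into entry `j` of array `a`. -/
def State.setArr (σ : State) (a j v : ℕ) : State :=
  { σ with arr := Function.update σ.arr a (Function.update (σ.arr a) j v) }

/-- `Exec p σ k τ`: started in state `σ`, the program `p` halts after exactly `k` steps in
state `τ`. -/
inductive Exec : Prog → State → ℕ → State → Prop
  | skip (σ : State) : Exec .skip σ 1 σ
  | assign (σ : State) (r : ℕ) (e : Exp) :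
      Exec (.assign r e) σ (e.cost + 1) (σ.setReg r (e.val σ))
  | store (σ : State) (a : ℕ) (idx e : Exp) :
      Exec (.store a idx e) σ (idx.cost + e.cost + 1) (σ.setArr a (idx.val σ) (e.val σ))
  | seq {p q : Prog} {σ τ υ : State} {k l : ℕ} (hp : Exec p σ k τ) (hq : Exec q τ l υ) :
      Exec (.seq p q) σ (k + l) υ
  | ite_true {e : Exp} {p q : Prog} {σ τ : State} {k : ℕ} (he : e.val σ ≠ 0)
      (hp : Exec p σ k τ) : Exec (.ite e p q) σ (e.cost + 1 + k) τ
  | ite_false {e : Exp} {p q : Prog} {σ τ : State} {k : ℕ} (he : e.val σ = 0)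
      (hq : Exec q σ k τ) : Exec (.ite e p q) σ (e.cost + 1 + k) τ
  | loop_done {e : Exp} {p : Prog} {σ : State} (he : e.val σ = 0) :
      Exec (.loop e p) σ (e.cost + 1) σ
  | loop_step {e : Exp} {p : Prog} {σ τ υ : State} {k l : ℕ} (he : e.val σ ≠ 0)
      (hp : Exec p σ k τ) (hl : Exec (.loop e p) τ l υ) :
      Exec (.loop e p) σ (e.cost + 1 + k + l) υ

end RAM

namespace RSC

variable {n : ℕ}

/-- The initial state on input `S`: register `0` holds the number of sensors, arrays `0`, `1`, `2`
hold the left endpoints, right endpoints and durations; everything else is `0`. -/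
def inputState (S : Fin n → Sensor) : RAM.State where
  reg r := if r = 0 then n else 0
  arr a i :=
    if h : i < n then
      if a = 0 then (S ⟨i, h⟩).left
      else if a = 1 then (S ⟨i, h⟩).right
      else if a = 2 then (S ⟨i, h⟩).dur
      else 0
    else 0

/-- The output read from a final state: array `3` holds the start times of the sensors. -/
def output (n : ℕ) (τ : RAM.State) (i : Fin n) : ℝ := (τ.arr 3 i : ℝ)

/-- The program halts on every nonempty instance, within a number of steps that is bounded by a
polynomial in the length of the input. -/
def RunsInPolyTime (p : RAM.Prog) : Prop :=
  ∃ P : Polynomial ℕ, ∀ (n : ℕ), 0 < n → ∀ S : Fin n → Sensor,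
    ∃ (k : ℕ) (τ : RAM.State), RAM.Exec p (inputState S) k τ ∧ k ≤ P.eval (inputSize S)

/-- On every nonempty instance with `n` sensors, whenever the program halts, its output is a
schedule of some duration `T` such that both the load and the duration of any schedule are at
most `ρ n * T`. -/
def Approximates (p : RAM.Prog) (ρ : ℕ → ℝ) : Prop :=
  ∀ (n : ℕ), 0 < n → ∀ (S : Fin n → Sensor) (k : ℕ) (τ : RAM.State),
    RAM.Exec p (inputState S) k τ →
      ∃ T : ℝ, IsSchedule S (output n τ) T ∧ (load S : ℝ) ≤ ρ n * T ∧
        ∀ (t' : Fin n → ℝ) (T' : ℝ), IsSchedule S t' T' → T' ≤ ρ n * T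

end RSC

/-! ### Bounded-loop programs: determinism, frame rules and running time. -/

namespace RAM

/-! A greedy algorithm attains the constant ratio 7, which is `O(log log n)` because `log log n`
tends to infinity.

The level of a point is 0 outside `U`, and otherwise one more than the latest stop time of the
scheduled sensors live there (1 if there are none). The algorithm takes the leftmost maximal gap
`[i, j)` of smallest positive level `m` and starts an unscheduled sensor there at time `m - 1`. If
the level at `j` is at most the level at `i - 1`, it takes the sensor live at `i` that reaches
farthest right; otherwise the one live at `j - 1` that reaches farthest left. Thus a sensor aims at
the side whose neighbour expires sooner. Eventually some point `x` of smallest level `T + 1` has all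
its live sensors scheduled (`Stuck`). Then `U` is covered during `[0, T)` and all sensors live at
`x` are active only within `[0, T)`. Since no point is covered more than 7 times at once, the load
at `x` is at most `7 * T`, and this load bounds both `L` and the duration of any schedule.

The overlap bound is `Run.card_active_le`. The sensors active at `x` are sorted by preferred
direction and by the position of their gap relative to `x`. There is at most one whose gap contains
`x`, as a gap is uncovered when it is filled. There is at most one that prefers right and comes from
a gap on the right of `x` (`Run.not_two_right`): of two, the later would have been the better choice
earlier. There are at most two that prefer right and come from a gap on the left
(`Run.IsOver.not_three`): if `b` is added while `a` is active, something just to the left of `b`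
outlives `a`, and it obstructs the gap that a third sensor would need. With the mirror images the
total is 1 + 1 + 1 + 2 + 2.

All loops of the program run over the sensors, so the step count is polynomial in `n`, and `n` is at
most the input length. Determinism transfers the analysis of this run to every halting run. -/

theorem Exec.state_unique {p : Prog} {σ τ τ' : State} {k k' : ℕ}
    (h : Exec p σ k τ) (h' : Exec p σ k' τ') : τ = τ' := by
  induction h generalizing k' τ' with
  | skip => cases h'; rfl
  | assign => cases h'; rfl
  | store => cases h'; rfl
  | seq _ _ ihp ihq =>
    cases h' with
    | seq hp' hq' => cases ihp hp'; exact ihq hq'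
  | ite_true he _ ih =>
    cases h' with
    | ite_true _ h => exact ih h
    | ite_false he' _ => exact absurd he' he
  | ite_false he _ ih =>
    cases h' with
    | ite_true he' _ => exact absurd he he'
    | ite_false _ h => exact ih h
  | loop_done he =>
    cases h' with
    | loop_done => rfl
    | loop_step he' => exact absurd he he'
  | loop_step he _ _ ihp ihl =>
    cases h' with
    | loop_done he' => exact absurd he' he
    | loop_step _ hp' hl' => cases ihp hp'; exact ihl hl'

namespace Exp

/-- The conjunction of two tests: their minimum. -/
def and (a b : Exp) : Exp := sub a (sub a b)
/-- The disjunction of two tests: their sum. -/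
def or (a b : Exp) : Exp := add a b
/-- The negation of a test. -/
def not (a : Exp) : Exp := sub (lit 1) a
/-- The test `a < b`. -/
def lt (a b : Exp) : Exp := sub b a
/-- The test `a ≤ b`. -/
def le (a b : Exp) : Exp := sub (add b (lit 1)) a
/-- The test `a ≠ b`. -/
def ne (a b : Exp) : Exp := add (sub a b) (sub b a)
/-- The test `a = b`. -/
def eq (a b : Exp) : Exp := not (ne a b)

variable (σ : State) (a b : Exp)

theorem val_and : (and a b).val σ = 0 ↔ a.val σ = 0 ∨ b.val σ = 0 := by
  simp only [and, val]; omega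
theorem val_or : (or a b).val σ = 0 ↔ a.val σ = 0 ∧ b.val σ = 0 := by
  simp only [or, val]; omega
theorem val_not : (not a).val σ = 0 ↔ ¬ a.val σ = 0 := by
  simp only [not, val]; omega
theorem val_lt : (lt a b).val σ = 0 ↔ ¬ a.val σ < b.val σ := by
  simp only [lt, val]; omega
theorem val_le : (le a b).val σ = 0 ↔ ¬ a.val σ ≤ b.val σ := by
  simp only [le, val]; omega
theorem val_ne : (ne a b).val σ = 0 ↔ ¬ a.val σ ≠ b.val σ := by
  simp only [ne, val]; omega
theorem val_eq : (eq a b).val σ = 0 ↔ ¬ a.val σ = b.val σ := by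
  simp only [eq, ne, not, val]; omega

end Exp

/-- Programs whose only loops run over all `c` less than the content of register `0`. -/
inductive ForProg where
  | skip
  | assign (r : ℕ) (e : Exp)
  | store (a : ℕ) (idx e : Exp)
  | seq (p q : ForProg)
  | ite (e : Exp) (p q : ForProg)
  | forN (c : ℕ) (p : ForProg)

namespace ForProg

/-- Translation to a program with unrestricted loops. -/
def compile : ForProg → Prog
  | skip => .skip
  | assign r e => .assign r e
  | store a idx e => .store a idx e
  | seq p q => .seq p.compile q.compile
  | ite e p q => .ite e p.compile q.compile
  | forN c p => .seq (.assign c (.lit 0)) (.loop (.sub (.var 0) (.var c))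
      (.seq p.compile (.assign c (.add (.var c) (.lit 1)))))

/-- The final state of a run. -/
def run : ForProg → State → State
  | skip, σ => σ
  | assign r e, σ => σ.setReg r (e.val σ)
  | store a idx e, σ => σ.setArr a (idx.val σ) (e.val σ)
  | seq p q, σ => q.run (p.run σ)
  | ite e p q, σ => if e.val σ = 0 then q.run σ else p.run σ
  | forN c p, σ =>
      (fun τ => (p.run τ).setReg c ((p.run τ).reg c + 1))^[σ.reg 0] (σ.setReg c 0)

/-- The registers that a program may write. -/
def regs : ForProg → List ℕ
  | skip => []
  | assign r _ => [r]
  | store _ _ _ => []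
  | seq p q => p.regs ++ q.regs
  | ite _ p q => p.regs ++ q.regs
  | forN c p => c :: p.regs

/-- The arrays that a program may write. -/
def arrs : ForProg → List ℕ
  | skip => []
  | assign _ _ => []
  | store a _ _ => [a]
  | seq p q => p.arrs ++ q.arrs
  | ite _ p q => p.arrs ++ q.arrs
  | forN _ p => p.arrs

/-- No loop counter is written in the body of its loop. -/
def WF : ForProg → Prop
  | skip => True
  | assign _ _ => True
  | store _ _ _ => True
  | seq p q => p.WF ∧ q.WF
  | ite _ p q => p.WF ∧ q.WF
  | forN c p => c ∉ p.regs ∧ p.WF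

/-- A bound for the number of steps, as a polynomial in the content of register `0`. -/
noncomputable def cost : ForProg → Polynomial ℕ
  | skip => 1
  | assign _ e => (e.cost + 1 : ℕ)
  | store _ idx e => (idx.cost + e.cost + 1 : ℕ)
  | seq p q => p.cost + q.cost
  | ite e p q => (e.cost + 1 : ℕ) + p.cost + q.cost
  | forN _ p => Polynomial.X * (p.cost + 8) + 6

theorem run_assign (r : ℕ) (e : Exp) (σ : State) : (assign r e).run σ = σ.setReg r (e.val σ) := rfl

theorem run_store (a : ℕ) (idx e : Exp) (σ : State) :
    (store a idx e).run σ = σ.setArr a (idx.val σ) (e.val σ) := rfl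

theorem run_seq (p q : ForProg) (σ : State) : (seq p q).run σ = q.run (p.run σ) := rfl

theorem run_skip (σ : State) : skip.run σ = σ := rfl

theorem run_ite (e : Exp) (p q : ForProg) (σ : State) :
    e.val σ = 0 ∧ (ite e p q).run σ = q.run σ ∨ e.val σ ≠ 0 ∧ (ite e p q).run σ = p.run σ := by
  by_cases h : e.val σ = 0
  · exact .inl ⟨h, if_pos h⟩
  · exact .inr ⟨h, if_neg h⟩

theorem reg_setReg_of_ne {σ : State} {r c v : ℕ} (h : r ≠ c) : (σ.setReg c v).reg r = σ.reg r := by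
  simp [State.setReg, Function.update_of_ne h]

@[simp] theorem reg_setReg_self {σ : State} {c v : ℕ} : (σ.setReg c v).reg c = v := by
  simp [State.setReg]

@[simp] theorem arr_setReg {σ : State} {c v : ℕ} : (σ.setReg c v).arr = σ.arr := rfl

@[simp] theorem reg_setArr {σ : State} {a c v : ℕ} : (σ.setArr a c v).reg = σ.reg := rfl

theorem reg_run {p : ForProg} {r : ℕ} (h : r ∉ p.regs) (σ : State) :
    (p.run σ).reg r = σ.reg r := by
  induction p generalizing σ with
  | skip => rfl
  | assign c e => exact reg_setReg_of_ne (by simpa [regs] using h)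
  | store => rfl
  | seq p q ihp ihq =>
    simp only [regs, List.mem_append, not_or] at h
    simp only [run, ihq h.2, ihp h.1]
  | ite e p q ihp ihq =>
    simp only [regs, List.mem_append, not_or] at h
    simp only [run]
    split_ifs
    · exact ihq h.2 σ
    · exact ihp h.1 σ
  | forN c p ih =>
    simp only [regs, List.mem_cons, not_or] at h
    simp only [run]
    generalize σ.reg 0 = k
    induction k with
    | zero => exact reg_setReg_of_ne h.1
    | succ k ihk => rw [Function.iterate_succ_apply', reg_setReg_of_ne h.1, ih h.2, ihk]

theorem arr_run {p : ForProg} {a : ℕ} (h : a ∉ p.arrs) (σ : State) :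
    (p.run σ).arr a = σ.arr a := by
  induction p generalizing σ with
  | skip => rfl
  | assign c e => rfl
  | store b => 
    simp only [arrs, List.mem_singleton] at h
    simp [run, State.setArr, Function.update_of_ne h]
  | seq p q ihp ihq =>
    simp only [arrs, List.mem_append, not_or] at h
    simp only [run, ihq h.2, ihp h.1]
  | ite e p q ihp ihq =>
    simp only [arrs, List.mem_append, not_or] at h
    simp only [run]
    split_ifs
    · exact ihq h.2 σ
    · exact ihp h.1 σ
  | forN c p ih =>
    simp only [arrs] at h
    simp only [run]
    generalize σ.reg 0 = k
    induction k with
    | zero => rfl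
    | succ k ihk => rw [Function.iterate_succ_apply', arr_setReg, ih h, ihk]

/-- The rule for loop invariants. Registers and arrays that are not written in the body may be
assumed to have their initial content. -/
theorem forN_induction {c : ℕ} {p : ForProg} {σ : State} (I : ℕ → State → Prop)
    (hc : c ∉ p.regs) (h0 : I 0 (σ.setReg c 0))
    (hs : ∀ k τ, k < σ.reg 0 → τ.reg c = k → (∀ r, r ≠ c → r ∉ p.regs → τ.reg r = σ.reg r) →
      (∀ a, a ∉ p.arrs → τ.arr a = σ.arr a) → I k τ → I (k + 1) ((p.run τ).setReg c (k + 1))) :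
    I (σ.reg 0) ((forN c p).run σ) := by
  simp only [run]
  suffices H : ∀ k, k ≤ σ.reg 0 → ∀ τ,
      τ = (fun τ => (p.run τ).setReg c ((p.run τ).reg c + 1))^[k] (σ.setReg c 0) →
      τ.reg c = k ∧ (∀ r, r ≠ c → r ∉ p.regs → τ.reg r = σ.reg r) ∧
      (∀ a, a ∉ p.arrs → τ.arr a = σ.arr a) ∧ I k τ from (H _ le_rfl _ rfl).2.2.2
  intro k
  induction k with
  | zero =>
    rintro - τ rfl
    exact ⟨reg_setReg_self, fun r hr _ => reg_setReg_of_ne hr, fun _ _ => rfl, h0⟩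
  | succ k ih =>
    rintro hk τ rfl
    rw [Function.iterate_succ_apply']
    generalize hτ : (fun τ => (p.run τ).setReg c ((p.run τ).reg c + 1))^[k] (σ.setReg c 0) = τ
    obtain ⟨h1, h2, h3, h4⟩ := ih (by omega) τ hτ.symm
    have h5 : (p.run τ).reg c = k := by rw [reg_run hc, h1]
    refine ⟨by simp [h5], fun r hr hp => ?_, fun a ha => ?_, ?_⟩
    · rw [reg_setReg_of_ne hr, reg_run hp, h2 r hr hp]
    · rw [arr_setReg, arr_run ha, h3 a ha]
    · rw [h5]
      exact hs k τ (by omega) h1 h2 h3 h4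

/-- Register `0` is never written, so every loop, however deeply nested, has the same number of
iterations, and one polynomial in that number bounds the steps. -/
theorem exec_compile {p : ForProg} (hp : p.WF) (h0 : 0 ∉ p.regs) (σ : State) :
    ∃ k ≤ p.cost.eval (σ.reg 0), Exec p.compile σ k (p.run σ) := by
  induction p generalizing σ with
  | skip => exact ⟨1, by simp [cost], .skip σ⟩
  | assign r e => exact ⟨_, by simp [cost], .assign σ r e⟩
  | store a idx e => exact ⟨_, by simp [cost], .store σ a idx e⟩
  | seq p q ihp ihq =>
    simp only [regs, List.mem_append, not_or] at h0
    obtain ⟨k, hk, h⟩ := ihp hp.1 h0.1 σ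
    obtain ⟨k', hk', h'⟩ := ihq hp.2 h0.2 (p.run σ)
    rw [reg_run h0.1] at hk'
    exact ⟨k + k', by simp only [cost, Polynomial.eval_add]; omega, .seq h h'⟩
  | ite e p q ihp ihq =>
    simp only [regs, List.mem_append, not_or] at h0
    simp only [run, cost, Polynomial.eval_add, Polynomial.eval_natCast]
    split_ifs with he
    · obtain ⟨k, hk, h⟩ := ihq hp.2 h0.2 σ
      exact ⟨_, by push_cast; omega, .ite_false he h⟩
    · obtain ⟨k, hk, h⟩ := ihp hp.1 h0.1 σ
      exact ⟨_, by push_cast; omega, .ite_true he h⟩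
  | forN c p ih =>
    simp only [regs, List.mem_cons, not_or] at h0
    obtain ⟨h0c, h0p⟩ := h0
    set B := p.cost.eval (σ.reg 0) with hB
    have loop : ∀ m k (τ : State), τ.reg 0 = σ.reg 0 → τ.reg c = k → k + m = σ.reg 0 →
        ∃ K ≤ m * (B + 8) + 4, Exec (.loop (.sub (.var 0) (.var c))
          (.seq p.compile (.assign c (.add (.var c) (.lit 1))))) τ K
          ((fun τ => (p.run τ).setReg c ((p.run τ).reg c + 1))^[m] τ) := by
      intro m
      induction m with
      | zero =>
        intro k τ h1 h2 h3
        exact ⟨_, by simp [Exp.cost], .loop_done (by simp only [Exp.val]; omega)⟩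
      | succ m ihm =>
        intro k τ h1 h2 h3
        obtain ⟨K, hK, h⟩ := ih hp.2 h0p τ
        have hc' : (p.run τ).reg c = k := by rw [reg_run hp.1, h2]
        obtain ⟨K', hK', h'⟩ := ihm (k + 1) ((p.run τ).setReg c ((p.run τ).reg c + 1))
          (by rw [reg_setReg_of_ne h0c, reg_run h0p, h1]) (by simp [hc']) (by omega)
        rw [h1, ← hB] at hK
        refine ⟨_, ?_, .loop_step (by simp only [Exp.val]; omega)
          (.seq h (.assign _ c _)) h'⟩
        -- One iteration costs 4 for the test and 4 for the increment besides the body, whence `B +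
        -- 8`; the summand 4 is the final failing test.
        simp only [Exp.cost]
        rw [Nat.succ_mul]
        omega
    obtain ⟨K, hK, h⟩ := loop (σ.reg 0) 0 (σ.setReg c 0) (reg_setReg_of_ne h0c)
      reg_setReg_self (by omega)
    -- The initialisation of the counter costs 2, which together with the failing test gives the 6
    -- in `cost`.
    refine ⟨_, ?_, .seq (.assign σ c (.lit 0)) h⟩
    have e8 : Polynomial.eval (σ.reg 0) (8 : Polynomial ℕ) = 8 := Polynomial.eval_ofNat _ _
    have e6 : Polynomial.eval (σ.reg 0) (6 : Polynomial ℕ) = 6 := Polynomial.eval_ofNat _ _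
    simp only [cost, Polynomial.eval_add, Polynomial.eval_mul, Polynomial.eval_X, e8, e6, Exp.cost,
      ← hB]
    omega

end ForProg
end RAM

/-! ### Combinatorics of greedy runs: the bound 7 on the overlap. -/

namespace RSC

/-- The combinatorial record of a run of the greedy algorithm. The `k`-th scheduled interval
`[l k, r k)` is active from time `m k` until time `e k`, and was chosen for the gap `[i k, j k)`
that was uncovered at time `m k`: if `R k`, it reaches farthest to the right among the intervals
that contain the first point of the gap, and otherwise it reaches farthest to the left among the
intervals that contain the last point of the gap. -/
structure Run (K : ℕ) where
  l : ℕ → ℤ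
  r : ℕ → ℤ
  i : ℕ → ℤ
  j : ℕ → ℤ
  m : ℕ → ℕ
  e : ℕ → ℕ
  R : ℕ → Prop
  lt : ∀ k < K, i k < j k
  mono : ∀ b < K, ∀ a < b, m a ≤ m b
  free : ∀ b < K, ∀ a < b, ∀ p, i b ≤ p → p < j b → l a ≤ p → p < r a → e a ≤ m b
  memR : ∀ k < K, R k → l k ≤ i k ∧ i k < r k
  domR : ∀ b < K, ∀ a < b, R a → l b ≤ i a → i a < r b → r b < r a ∨ r b = r a ∧ l a ≤ l b
  nbrR : ∀ k < K, R k → j k < r k → ∃ z < k, ∃ B < k, l z ≤ i k - 1 ∧ i k - 1 < r z ∧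
    l B ≤ j k ∧ j k < r B ∧ m k < e B ∧ ∀ b < k, l b ≤ j k → j k < r b → e b ≤ e z
  memL : ∀ k < K, ¬ R k → l k ≤ j k - 1 ∧ j k - 1 < r k
  domL : ∀ b < K, ∀ a < b, ¬ R a → l b ≤ j a - 1 → j a - 1 < r b →
    l a < l b ∨ l b = l a ∧ r b ≤ r a
  nbrL : ∀ k < K, ¬ R k → l k ≤ i k - 1 → ∃ z < k, ∃ B < k, l z ≤ j k ∧ j k < r z ∧
    l B ≤ i k - 1 ∧ i k - 1 < r B ∧ m k < e B ∧
    ∀ b < k, l b ≤ i k - 1 → i k - 1 < r b → e b ≤ e z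

namespace Run

variable {K : ℕ} (P : Run K)

/-- The reflection of a run at the origin. -/
def mirror : Run K where
  -- The reflection `p ↦ -p` sends the integer points of `[l, r)` to those of `[1 - r, 1 - l)`.
  l k := 1 - P.r k
  r k := 1 - P.l k
  i k := 1 - P.j k
  j k := 1 - P.i k
  m := P.m
  e := P.e
  R k := ¬ P.R k
  lt k hk := by have := P.lt k hk; omega
  mono := P.mono
  free b hb a hab p h1 h2 h3 h4 :=
    P.free b hb a hab (-p) (by omega) (by omega) (by omega) (by omega)
  memR k hk h := by have := P.memL k hk h; omega
  domR b hb a hab h h1 h2 := by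
    have := P.domL b hb a hab h (by omega) (by omega); omega
  nbrR k hk h h1 := by
    obtain ⟨z, hz, B, hB, h2, h3, h4, h5, h6, h7⟩ := P.nbrL k hk h (by omega)
    exact ⟨z, hz, B, hB, by omega, by omega, by omega, by omega, h6,
      fun b hb h8 h9 => h7 b hb (by omega) (by omega)⟩
  memL k hk h := by have := P.memR k hk (not_not.1 h); omega
  domL b hb a hab h h1 h2 := by
    have := P.domR b hb a hab (not_not.1 h) (by omega) (by omega); omega
  nbrL k hk h h1 := by
    obtain ⟨z, hz, B, hB, h2, h3, h4, h5, h6, h7⟩ := P.nbrR k hk (not_not.1 h) (by omega)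
    exact ⟨z, hz, B, hB, by omega, by omega, by omega, by omega, h6,
      fun b hb h8 h9 => h7 b hb (by omega) (by omega)⟩

/-- An interval is never properly contained in one that is scheduled later. -/
theorem not_ssubset {a b : ℕ} (hb : b < K) (hab : a < b) (hl : P.l b ≤ P.l a)
    (hr : P.r a ≤ P.r b) : P.l b = P.l a ∧ P.r a = P.r b := by
  -- The point at which `a` was selected lies in `b` too, so `b` was a candidate then; the tie-break
  -- excludes even one-sided extension.
  by_cases h : P.R a
  · have h1 := P.memR a (hab.trans hb) h
    have h2 := P.domR b hb a hab h (by omega) (by omega)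
    omega
  · have h1 := P.memL a (hab.trans hb) h
    have h2 := P.domL b hb a hab h (by omega) (by omega)
    omega

/-- Interval `k` contains `x` and was chosen for a gap on the left of `x`, as the one that reaches
farthest to the right. -/
def IsOver (x : ℤ) (k : ℕ) : Prop := k < K ∧ P.R k ∧ P.j k ≤ x ∧ P.l k ≤ x ∧ x < P.r k

variable {P} {x : ℤ}

/-- The left neighbour of the gap of `b` also covers the point to the left of interval `b`. -/
theorem IsOver.exists_left {b : ℕ} (h : P.IsOver x b) : ∃ z < b, P.l z ≤ P.l b - 1 ∧
    P.l b - 1 < P.r z ∧ ∀ c < b, P.l c ≤ P.j b → P.j b < P.r c → P.e c ≤ P.e z := by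
  obtain ⟨hb, hR, h1, h2, h3⟩ := h
  obtain ⟨z, hz, B, hB, h4, h5, h6, h7, h8, h9⟩ := P.nbrR b hb hR (by omega)
  have h10 := P.memR b hb hR
  have h11 := P.lt b hb
  -- Since `z` outlives `B`, which is active at time `m b`, it cannot meet the gap of `b`.
  have h12 : ¬ P.i b < P.r z := fun h => by
    have := P.free b hb z hz (P.i b) le_rfl h11 (by omega) h
    have := h9 B hB h6 h7
    omega
  -- Otherwise `z` would be properly contained in the later interval `b`.
  have h13 : P.l z < P.l b := by
    by_contra h
    have := P.not_ssubset hb hz (by omega) (by omega)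
    omega
  exact ⟨z, hz, by omega, by omega, h9⟩

/-- Both intervals reach past `x`, so if `a` began earlier it would cover the last point of the gap
of `b` while still active. -/
theorem IsOver.le_left {a b : ℕ} (ha : P.IsOver x a) (hb : P.IsOver x b) (hab : a < b)
    (hm : P.m b < P.e a) : P.j b ≤ P.l a := by
  by_contra h
  have h1 := P.free b hb.1 a hab (P.j b - 1) (by have := P.lt b hb.1; omega) (by omega)
    (by omega) (by have := ha.2.2.2; have := hb.2.2.1; omega)
  omega

/-- The interval `c` is the one that keeps the right neighbour `j b` covered beyond time `m b`. It
must begin exactly at `j b`, as it cannot meet the gap. The order of selection and the preferences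
then force it to be another interval of the same kind, chosen between `a` and `b`. -/
theorem IsOver.exists_between {a b : ℕ} (ha : P.IsOver x a) (hb : P.IsOver x b) (hab : a < b)
    (hm : P.m b < P.e a) (hj : P.j b ≠ P.l a) :
    ∃ c, a < c ∧ c < b ∧ P.IsOver x c ∧ P.l c = P.j b ∧ P.m b < P.e c := by
  have hle := ha.le_left hb hab hm
  obtain ⟨haK, haR, ha1, ha2, ha3⟩ := ha
  obtain ⟨hbK, hbR, hb1, hb2, hb3⟩ := hb
  have hbg := P.lt b hbK
  have hag := P.lt a haK
  have hbi := P.memR b hbK hbR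
  have hai := P.memR a haK haR
  obtain ⟨z, hz, c, hc, h4, h5, h6, h7, h8, h9⟩ := P.nbrR b hbK hbR (by omega)
  have hl : P.l c = P.j b := by
    by_contra h
    have := P.free b hbK c hc (P.j b - 1) (by omega) (by omega) (by omega) (by omega)
    omega
  have hr : P.r b < P.r c := by
    by_contra h
    have := P.not_ssubset hbK hc (by omega) (by omega)
    omega
  have hcK := hc.trans hbK
  have hcg := P.lt c hcK
  -- An earlier `c` would cover the first point of the gap of `a` while active.
  have hac : a < c := by
    rcases lt_trichotomy c a with h | h | h
    · have := P.free a haK c h (P.i a) le_rfl hag (by omega) (by omega)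
      have := P.mono b hbK a hab
      omega
    · subst h; omega
    · exact h
  have hrc : P.r c < P.r a := by
    by_contra h
    have := P.not_ssubset hcK hac (by omega) (by omega)
    omega
  have hmc := P.mono b hbK c hc
  have hcj : P.j c ≤ P.l a := by
    by_contra h
    by_cases h' : P.R c
    · have := P.memR c hcK h'
      have := P.free c hcK a hac (max (P.i c) (P.l a)) (by omega) (by omega) (by omega) (by omega)
      omega
    · have := P.memL c hcK h'
      have := P.free c hcK a hac (P.j c - 1) (by omega) (by omega) (by omega) (by omega)
      omega
  -- With preference to the left, `b` would have beaten `c`: it contains `j c - 1` and begins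
  -- farther left.
  have hcR : P.R c := by
    by_contra h
    have h1 := P.memL c hcK h
    have := P.domL b hbK c hc h (by omega) (by omega)
    omega
  exact ⟨c, hac, hc, ⟨hcK, hcR, by omega, by omega, by omega⟩, hl, h8⟩

/-- The left neighbour of the gap of `b` outlives interval `a`. -/
theorem IsOver.exists_left_of_lt {a b : ℕ} (ha : P.IsOver x a) (hb : P.IsOver x b) (hab : a < b)
    (hm : P.m b < P.e a) :
    ∃ z < b, P.l z ≤ P.l b - 1 ∧ P.l b - 1 < P.r z ∧ P.e a ≤ P.e z := by
  induction b using Nat.strong_induction_on with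
  | _ b ih =>
  by_cases hj : P.j b = P.l a
  · obtain ⟨z, hz, h1, h2, h3⟩ := hb.exists_left
    exact ⟨z, hz, h1, h2, h3 a hab hj.ge (by have := ha.2.2.2; have := hb.2.2.1; omega)⟩
  -- This case is in fact impossible: the `z` obtained for `c` covers `l c - 1 = j b - 1`, the last
  -- point of the gap of `b`, beyond time `m b`.
  · obtain ⟨c, hac, hcb, hc, hlc, hec⟩ := ha.exists_between hb hab hm hj
    have hmc := P.mono b hb.1 c hcb
    obtain ⟨z, hz, h1, h2, h3⟩ := ih c hcb hc hac (by omega)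
    have hg := P.lt b hb.1
    have := P.free b hb.1 z (hz.trans hcb) (P.j b - 1) (by omega) (by omega) (by omega) (by omega)
    omega

/-- Some `z` covers `l b - 1` for at least as long as `a` is active. If the gap of `c` ends at `l
b`, then `z` covers its last point at time `m c`, which is absurd. Otherwise `exists_between`
replaces `c` by an earlier interval, and induction applies. -/
theorem IsOver.not_three {a b c y : ℕ} (ha : P.IsOver x a) (hb : P.IsOver x b) (hc : P.IsOver x c)
    (hab : a < b) (hbc : b < c) (hya : y < P.e a) (hyb : y < P.e b) (hyc : P.m c ≤ y) : False := by
  have hmb := P.mono c hc.1 b hbc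
  obtain ⟨z, hz, h1, h2, h3⟩ := ha.exists_left_of_lt hb hab (by omega)
  induction c using Nat.strong_induction_on with
  | _ c ih =>
  by_cases hj : P.j c = P.l b
  · have hg := P.lt c hc.1
    have := P.free c hc.1 z (hz.trans hbc) (P.j c - 1) (by omega) (by omega) (by omega) (by omega)
    omega
  · obtain ⟨d, hbd, hdc, hd, -, -⟩ := hb.exists_between hc hbc (by omega) hj
    have hmd := P.mono c hc.1 d hdc
    exact ih d hdc hd hbd (by omega) (P.mono d hd.1 b hbd)

/-- At most one active interval that contains `x` was chosen for a gap on the right of `x` as the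
one that reaches farthest to the right. -/
theorem not_two_right {a b y : ℕ} (hb : b < K) (hab : a < b) (hRa : P.R a) (hRb : P.R b)
    (hxa : P.l a ≤ x ∧ x < P.r a) (hxb : P.l b ≤ x) (hia : x < P.i a) (hib : x < P.i b)
    (hya : y < P.e a) (hyb : P.m b ≤ y) : False := by
  have h1 := P.memR a (hab.trans hb) hRa
  have h2 := P.memR b hb hRb
  have h3 : P.r a ≤ P.i b := by
    by_contra h
    have := P.free b hb a hab (P.i b) le_rfl (P.lt b hb) (by omega) (by omega)
    omega
  -- Here `b` contains `i a` and reaches past `i b ≥ r a`, so it should have been preferred to `a`.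
  have := P.domR b hb a hab hRa (by omega) (by omega)
  omega

theorem _root_.Finset.card_le_one_of_not_lt {s : Finset ℕ}
    (h : ∀ a ∈ s, ∀ b ∈ s, ¬ a < b) : s.card ≤ 1 :=
  Finset.card_le_one.2 fun a ha b hb => le_antisymm (not_lt.1 (h b hb a ha)) (not_lt.1 (h a ha b hb))

theorem _root_.Finset.card_le_two_of_not_lt {s : Finset ℕ}
    (h : ∀ a ∈ s, ∀ b ∈ s, ∀ c ∈ s, a < b → ¬ b < c) : s.card ≤ 2 := by
  by_contra hs
  have hs : 3 ≤ s.card := by omega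
  let f := s.orderEmbOfCardLe hs
  exact h (f 0) (s.orderEmbOfCardLe_mem hs 0) (f 1) (s.orderEmbOfCardLe_mem hs 1) (f 2)
    (s.orderEmbOfCardLe_mem hs 2) (f.lt_iff_lt.2 (by decide)) (f.lt_iff_lt.2 (by decide))

variable (P x)

open Classical in
/-- No point is covered more than seven times at any time. -/
theorem card_active_le (y : ℕ) :
    ((Finset.range K).filter fun k => P.l k ≤ x ∧ x < P.r k ∧ P.m k ≤ y ∧ y < P.e k).card ≤ 7 := by
  set A := (Finset.range K).filter fun k => P.l k ≤ x ∧ x < P.r k ∧ P.m k ≤ y ∧ y < P.e k with hA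
  have mem : ∀ k ∈ A, k < K ∧ P.l k ≤ x ∧ x < P.r k ∧ P.m k ≤ y ∧ y < P.e k := by simp [hA]
  have h1 : (A.filter fun k => P.i k ≤ x ∧ x < P.j k).card ≤ 1 := by
    refine Finset.card_le_one_of_not_lt fun a ha b hb hab => ?_
    rw [Finset.mem_filter] at ha hb
    have ha' := mem a ha.1
    have hb' := mem b hb.1
    have := P.free b hb'.1 a hab x hb.2.1 hb.2.2 ha'.2.1 ha'.2.2.1
    omega
  have h2 : (A.filter fun k => P.R k ∧ x < P.i k).card ≤ 1 := by
    refine Finset.card_le_one_of_not_lt fun a ha b hb hab => ?_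
    rw [Finset.mem_filter] at ha hb
    have ha' := mem a ha.1
    have hb' := mem b hb.1
    exact not_two_right (P := P) (x := x) (y := y) hb'.1 hab ha.2.1 hb.2.1 (by omega) (by omega)
      ha.2.2 hb.2.2 (by omega) (by omega)
  have h3 : (A.filter fun k => ¬ P.R k ∧ P.j k ≤ x).card ≤ 1 := by
    refine Finset.card_le_one_of_not_lt fun a ha b hb hab => ?_
    rw [Finset.mem_filter] at ha hb
    have ha' := mem a ha.1
    have hb' := mem b hb.1
    exact not_two_right (P := P.mirror) (x := -x) (y := y) hb'.1 hab ha.2.1 hb.2.1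
      (by simp only [mirror]; omega) (by simp only [mirror]; omega) (by simp only [mirror]; omega)
      (by simp only [mirror]; omega) (by simp only [mirror]; omega) (by simp only [mirror]; omega)
  have h4 : (A.filter fun k => P.R k ∧ P.j k ≤ x).card ≤ 2 := by
    refine Finset.card_le_two_of_not_lt fun a ha b hb c hc hab hbc => ?_
    rw [Finset.mem_filter] at ha hb hc
    have ha' := mem a ha.1
    have hb' := mem b hb.1
    have hc' := mem c hc.1
    exact IsOver.not_three (P := P) (x := x) (y := y) ⟨ha'.1, ha.2.1, ha.2.2, by omega, by omega⟩
      ⟨hb'.1, hb.2.1, hb.2.2, by omega, by omega⟩ ⟨hc'.1, hc.2.1, hc.2.2, by omega, by omega⟩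
      hab hbc (by omega) (by omega) (by omega)
  have h5 : (A.filter fun k => ¬ P.R k ∧ x < P.i k).card ≤ 2 := by
    refine Finset.card_le_two_of_not_lt fun a ha b hb c hc hab hbc => ?_
    rw [Finset.mem_filter] at ha hb hc
    have key : ∀ k ∈ A, ¬ P.R k → x < P.i k → P.mirror.IsOver (-x) k := fun k hk h h' => by
      have := mem k hk
      refine ⟨this.1, h, ?_, ?_, ?_⟩ <;> simp only [mirror] <;> omega
    exact (key a ha.1 ha.2.1 ha.2.2).not_three (key b hb.1 hb.2.1 hb.2.2)
      (key c hc.1 hc.2.1 hc.2.2) hab hbc (mem a ha.1).2.2.2.2 (mem b hb.1).2.2.2.2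
      (mem c hc.1).2.2.2.1
  -- A gap contains `x`, lies to its right or lies to its left; with the two preferences this yields
  -- five classes.
  have hsub : A ⊆ ((((A.filter fun k => P.i k ≤ x ∧ x < P.j k) ∪
      (A.filter fun k => P.R k ∧ x < P.i k)) ∪ (A.filter fun k => ¬ P.R k ∧ P.j k ≤ x)) ∪
      (A.filter fun k => P.R k ∧ P.j k ≤ x)) ∪ (A.filter fun k => ¬ P.R k ∧ x < P.i k) := by
    intro k hk
    simp only [Finset.mem_union, Finset.mem_filter, hk, true_and]
    by_cases hR : P.R k <;> simp only [hR, not_true, not_false_iff, true_and, false_and] <;> omega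
  refine (Finset.card_le_card hsub).trans ?_
  refine (Finset.card_union_le _ _).trans ?_
  have u1 := Finset.card_union_le (((A.filter fun k => P.i k ≤ x ∧ x < P.j k) ∪
      (A.filter fun k => P.R k ∧ x < P.i k)) ∪ (A.filter fun k => ¬ P.R k ∧ P.j k ≤ x))
      (A.filter fun k => P.R k ∧ P.j k ≤ x)
  have u2 := Finset.card_union_le ((A.filter fun k => P.i k ≤ x ∧ x < P.j k) ∪
      (A.filter fun k => P.R k ∧ x < P.i k)) (A.filter fun k => ¬ P.R k ∧ P.j k ≤ x)
  have u3 := Finset.card_union_le (A.filter fun k => P.i k ≤ x ∧ x < P.j k)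
      (A.filter fun k => P.R k ∧ x < P.i k)
  omega

end Run
end RSC

/-! ### Levels, endpoints and specifications of the searches. -/

namespace RSC

/-- The level at `x`: the maximum of `e` over the sensors among the first `n` that are live at
`x`. -/
def level (l r e : ℕ → ℕ) (n x : ℕ) : ℕ :=
  (Finset.range n).sup fun s => if l s ≤ x ∧ x < r s then e s else 0

/-- The left and right endpoints of the first `n` sensors. -/
def IsEndpoint (l r : ℕ → ℕ) (n x : ℕ) : Prop := ∃ s < n, x = l s ∨ x = r s

/-- Among the first `n` sensors that are not scheduled (`e s = 1`) and live at `q`, sensor `B - 1` is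
best for the preference `better`, and `B = 0` if there are none. -/
structure IsBest (l r e : ℕ → ℕ) (n q : ℕ) (better : ℕ → ℕ → Prop) (B : ℕ) : Prop where
  none : B = 0 → ∀ s < n, e s = 1 → ¬ (l s ≤ q ∧ q < r s)
  some : B ≠ 0 → B - 1 < n ∧ e (B - 1) = 1 ∧ l (B - 1) ≤ q ∧ q < r (B - 1) ∧
    ∀ s < n, e s = 1 → l s ≤ q → q < r s → ¬ better s (B - 1)

/-- Sensor `s` reaches farther to the right than `b`, or equally far and farther to the left. -/
def BetterRight (l r : ℕ → ℕ) (s b : ℕ) : Prop := r b < r s ∨ r s = r b ∧ l s < l b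

/-- Sensor `s` reaches farther to the left than `b`, or equally far and farther to the right. -/
def BetterLeft (l r : ℕ → ℕ) (s b : ℕ) : Prop := l s < l b ∨ l s = l b ∧ r b < r s

theorem level_succ (l r e : ℕ → ℕ) (k x : ℕ) :
    level l r e (k + 1) x = max (if l k ≤ x ∧ x < r k then e k else 0) (level l r e k x) := by
  rw [level, Finset.range_add_one, Finset.sup_insert]; rfl

theorem isEndpoint_succ (l r : ℕ → ℕ) (k : ℕ) :
    IsEndpoint l r (k + 1) = fun x => (IsEndpoint l r k x ∨ x = l k) ∨ x = r k := by
  funext x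
  simp only [IsEndpoint, Nat.lt_succ_iff_lt_or_eq, or_and_right, exists_or, exists_eq_left,
    or_assoc]

/-- After some endpoints have been considered, those in `C`, the smallest positive level
is `m` and the leftmost endpoint with this level is `i`. -/
structure MinSpec (l r e : ℕ → ℕ) (n : ℕ) (C : ℕ → Prop) (m i : ℕ) : Prop where
  mem : m ≠ 0 → C i ∧ level l r e n i = m
  le : ∀ x, C x → level l r e n x ≠ 0 →
    m ≠ 0 ∧ m ≤ level l r e n x ∧ (level l r e n x = m → i ≤ x)

/-- After some endpoints have been considered, those in `C`, the first one after `i`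
where the level is not `m` is `j`, and `j = 0` if there are none. -/
structure NextSpec (l r e : ℕ → ℕ) (n : ℕ) (C : ℕ → Prop) (m i j : ℕ) : Prop where
  mem : j ≠ 0 → C j ∧ i < j ∧ level l r e n j ≠ m
  le : ∀ x, C x → i < x → level l r e n x ≠ m → j ≠ 0 ∧ j ≤ x

/-- The sensor `B - 1` is the greedy choice for the gap `[i, j)`, and `B = 0` if there is no
candidate. -/
def IsChoice (l r e : ℕ → ℕ) (n i j B : ℕ) : Prop :=
  level l r e n j ≤ level l r e n (i - 1) ∧ IsBest l r e n i (BetterRight l r) B ∨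
  level l r e n (i - 1) ≤ level l r e n j ∧ IsBest l r e n (j - 1) (BetterLeft l r) B

end RSC

/-! ### The greedy program and the correctness of its subroutines. -/

namespace RAM.ForProg

open Exp RSC

/-- Register `2` receives the level at the content of register `1`. -/
def levelProg : ForProg :=
  seq (assign 2 (lit 0)) (forN 3
    (ite (and (le (get 0 (var 3)) (var 1))
        (and (lt (var 1) (get 1 (var 3))) (lt (var 2) (get 4 (var 3)))))
      (assign 2 (get 4 (var 3))) skip))

/-- Registers `5` and `6` receive the smallest positive level at an endpoint and the leftmost such
endpoint. -/
def considerMin : ForProg :=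
  seq levelProg (ite (and (var 2) (or (not (var 5))
      (or (lt (var 2) (var 5)) (and (eq (var 2) (var 5)) (lt (var 1) (var 6))))))
    (seq (assign 5 (var 2)) (assign 6 (var 1))) skip)

def findMinBody : ForProg :=
  seq (seq (assign 1 (get 0 (var 4))) considerMin)
    (seq (assign 1 (get 1 (var 4))) considerMin)

def findMin : ForProg := seq (assign 5 (lit 0)) (forN 4 findMinBody)

/-- Register `7` receives the first endpoint after register `6` where the level is not the content
of register `5`. -/
def considerNext : ForProg :=
  seq levelProg (ite (and (lt (var 6) (var 1)) (and (ne (var 2) (var 5))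
      (or (not (var 7)) (lt (var 1) (var 7)))))
    (assign 7 (var 1)) skip)

def findNextBody : ForProg :=
  seq (seq (assign 1 (get 0 (var 4))) considerNext)
    (seq (assign 1 (get 1 (var 4))) considerNext)

def findNext : ForProg := seq (assign 7 (lit 0)) (forN 4 findNextBody)

/-- Register `9` receives one plus the index of a sensor that is best for the test `better` among
those that are not scheduled and live at the content of register `1`, or zero if there are none. -/
def select (better : Exp) : ForProg :=
  seq (assign 9 (lit 0)) (forN 3
    (ite (and (and (eq (get 4 (var 3)) (lit 1))
          (and (le (get 0 (var 3)) (var 1)) (lt (var 1) (get 1 (var 3)))))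
        (or (not (var 9)) better))
      (assign 9 (add (var 3) (lit 1))) skip))

def betterRight : Exp :=
  or (lt (get 1 (sub (var 9) (lit 1))) (get 1 (var 3)))
    (and (eq (get 1 (var 3)) (get 1 (sub (var 9) (lit 1))))
      (lt (get 0 (var 3)) (get 0 (sub (var 9) (lit 1)))))

def betterLeft : Exp :=
  or (lt (get 0 (var 3)) (get 0 (sub (var 9) (lit 1))))
    (and (eq (get 0 (var 3)) (get 0 (sub (var 9) (lit 1))))
      (lt (get 1 (sub (var 9) (lit 1))) (get 1 (var 3))))

/-- The choice of a sensor for the gap from register `6` to register `7`. -/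
def choose : ForProg :=
  seq (seq (assign 1 (sub (var 6) (lit 1))) levelProg)
    (seq (assign 8 (var 2))
      (seq (seq (assign 1 (var 7)) levelProg)
        (ite (le (var 2) (var 8))
          (seq (assign 1 (var 6)) (select betterRight))
          (seq (assign 1 (sub (var 7) (lit 1))) (select betterLeft)))))

/-- The chosen sensor is scheduled at the smallest level. -/
def schedule : ForProg :=
  ite (var 9)
    (seq (store 3 (sub (var 9) (lit 1)) (sub (var 5) (lit 1)))
      (store 4 (sub (var 9) (lit 1)) (add (var 5) (get 2 (sub (var 9) (lit 1)))))) skip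

/-- The body of the main loop. -/
def greedyBody : ForProg := seq (seq findMin findNext) (seq choose schedule)

/-- The greedy algorithm. Entry `s` of array `4` is `1` if sensor `s` is not scheduled, and
one plus the time when it ceases to be active otherwise. -/
def greedy : ForProg :=
  seq (forN 3 (store 4 (var 3) (lit 1))) (forN 10 greedyBody)

theorem reg_levelProg (σ : State) :
    (levelProg.run σ).reg 2 = level (σ.arr 0) (σ.arr 1) (σ.arr 4) (σ.reg 0) (σ.reg 1) := by
  let τ := σ.setReg 2 0
  refine forN_induction (σ := τ) (c := 3)
    (fun k υ => υ.reg 2 = level (σ.arr 0) (σ.arr 1) (σ.arr 4) k (σ.reg 1))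
    (by decide) rfl fun k υ hk h3 hr ha h => ?_
  have h1 : υ.reg 1 = σ.reg 1 := hr 1 (by decide) (by decide)
  have ha0 : υ.arr 0 = σ.arr 0 := ha 0 (by decide)
  have ha1 : υ.arr 1 = σ.arr 1 := ha 1 (by decide)
  have ha4 : υ.arr 4 = σ.arr 4 := ha 4 (by decide)
  rw [reg_setReg_of_ne (by decide), level_succ, ← h]
  rcases run_ite _ _ _ υ with ⟨hc, hr⟩ | ⟨hc, hr⟩ <;> rw [hr] <;>
    simp only [ne_eq, val_and, val_le, val_lt, val, h3, h1, ha0, ha1, ha4] at hc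
  · rw [run_skip]
    split_ifs <;> omega
  · rw [run_assign, reg_setReg_self]
    simp only [val, h3, ha4]
    split_ifs <;> omega

theorem considerMin_spec (σ : State) (C : ℕ → Prop)
    (h : MinSpec (σ.arr 0) (σ.arr 1) (σ.arr 4) (σ.reg 0) C (σ.reg 5) (σ.reg 6)) :
    MinSpec (σ.arr 0) (σ.arr 1) (σ.arr 4) (σ.reg 0) (fun x => C x ∨ x = σ.reg 1)
      ((considerMin.run σ).reg 5) ((considerMin.run σ).reg 6) := by
  have h2 := reg_levelProg σ
  have h1 : (levelProg.run σ).reg 1 = σ.reg 1 := reg_run (by decide) σ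
  have h5 : (levelProg.run σ).reg 5 = σ.reg 5 := reg_run (by decide) σ
  have h6 : (levelProg.run σ).reg 6 = σ.reg 6 := reg_run (by decide) σ
  rw [considerMin, run_seq]
  generalize levelProg.run σ = τ at *
  generalize hL : level (σ.arr 0) (σ.arr 1) (σ.arr 4) (σ.reg 0) = L at *
  obtain ⟨hm, hle⟩ := h
  rw [hL] at hm hle
  rcases run_ite _ _ _ τ with ⟨hc, hr⟩ | ⟨hc, hr⟩ <;> rw [hr] <;>
    simp only [ne_eq, val_and, val_or, val_not, val_lt, val_eq, val, h1, h2, h5, h6] at hc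
  · rw [run_skip, h5, h6]
    constructor
    · intro h0; rw [hL]; exact ⟨Or.inl (hm h0).1, (hm h0).2⟩
    · rw [hL]
      rintro x (hx | rfl) h0
      · exact hle x hx h0
      · omega
  · simp only [run_seq, run_assign, val, reg_setReg_self, reg_setReg_of_ne (show 5 ≠ 6 by decide),
      h1, reg_setReg_of_ne (show 1 ≠ 5 by decide), h2]
    constructor
    · intro h0; rw [hL]; exact ⟨Or.inr rfl, rfl⟩
    · rw [hL]
      rintro x (hx | rfl) h0
      · have := hle x hx h0; omega
      · omega

theorem findMin_spec (σ : State) :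
    MinSpec (σ.arr 0) (σ.arr 1) (σ.arr 4) (σ.reg 0)
      (IsEndpoint (σ.arr 0) (σ.arr 1) (σ.reg 0))
      ((findMin.run σ).reg 5) ((findMin.run σ).reg 6) := by
  rw [findMin, run_seq, run_assign]
  refine forN_induction (p := findMinBody) (σ := σ.setReg 5 _) (c := 4)
    (fun k υ => MinSpec (σ.arr 0) (σ.arr 1) (σ.arr 4) (σ.reg 0)
      (IsEndpoint (σ.arr 0) (σ.arr 1) k) (υ.reg 5) (υ.reg 6))
    (by decide) ⟨fun h => absurd rfl h, fun x ⟨s, hs, _⟩ => absurd hs (Nat.not_lt_zero s)⟩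
    fun k υ hk h4 hr ha h => ?_
  have h0 : υ.reg 0 = σ.reg 0 := hr 0 (by decide) (by decide)
  have ha0 : υ.arr 0 = σ.arr 0 := ha 0 (by decide)
  have ha1 : υ.arr 1 = σ.arr 1 := ha 1 (by decide)
  have ha4 : υ.arr 4 = σ.arr 4 := ha 4 (by decide)
  have s1 := considerMin_spec (υ.setReg 1 (υ.arr 0 (υ.reg 4))) (IsEndpoint (σ.arr 0) (σ.arr 1) k)
    (by simpa only [arr_setReg, ha0, ha1, ha4, h0, reg_setReg_of_ne (show 0 ≠ 1 by decide),
      reg_setReg_of_ne (show 5 ≠ 1 by decide), reg_setReg_of_ne (show 6 ≠ 1 by decide)] using h)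
  set υ' := considerMin.run (υ.setReg 1 (υ.arr 0 (υ.reg 4))) with hυ'
  have g0 : υ'.reg 0 = σ.reg 0 := (reg_run (by decide) _).trans h0
  have g4 : υ'.reg 4 = k := (reg_run (by decide) _).trans h4
  have ga0 : υ'.arr 0 = σ.arr 0 := (arr_run (by decide) _).trans ha0
  have ga1 : υ'.arr 1 = σ.arr 1 := (arr_run (by decide) _).trans ha1
  have ga4 : υ'.arr 4 = σ.arr 4 := (arr_run (by decide) _).trans ha4
  simp only [arr_setReg, ha0, ha1, ha4, reg_setReg_self, h4, h0,
    reg_setReg_of_ne (show 0 ≠ 1 by decide)] at s1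
  have s2 := considerMin_spec (υ'.setReg 1 (υ'.arr 1 (υ'.reg 4)))
    (fun x => IsEndpoint (σ.arr 0) (σ.arr 1) k x ∨ x = σ.arr 0 k)
    (by simpa only [arr_setReg, ga0, ga1, ga4, g0, reg_setReg_of_ne (show 0 ≠ 1 by decide),
      reg_setReg_of_ne (show 5 ≠ 1 by decide), reg_setReg_of_ne (show 6 ≠ 1 by decide)] using s1)
  simp only [arr_setReg, ga0, ga1, ga4, reg_setReg_self, g4, g0,
    reg_setReg_of_ne (show 0 ≠ 1 by decide)] at s2
  have hrun : findMinBody.run υ = considerMin.run (υ'.setReg 1 (σ.arr 1 k)) := by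
    rw [findMinBody, run_seq, run_seq, run_seq, run_assign, run_assign, Exp.val, Exp.val, Exp.val,
      ← hυ', Exp.val, g4, ga1]
  rw [reg_setReg_of_ne (show 5 ≠ 4 by decide), reg_setReg_of_ne (show 6 ≠ 4 by decide), hrun,
    isEndpoint_succ]
  exact s2

theorem considerNext_spec (σ : State) (C : ℕ → Prop)
    (h : NextSpec (σ.arr 0) (σ.arr 1) (σ.arr 4) (σ.reg 0) C (σ.reg 5) (σ.reg 6) (σ.reg 7)) :
    NextSpec (σ.arr 0) (σ.arr 1) (σ.arr 4) (σ.reg 0) (fun x => C x ∨ x = σ.reg 1)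
      (σ.reg 5) (σ.reg 6) ((considerNext.run σ).reg 7) := by
  have h2 := reg_levelProg σ
  have h1 : (levelProg.run σ).reg 1 = σ.reg 1 := reg_run (by decide) σ
  have h5 : (levelProg.run σ).reg 5 = σ.reg 5 := reg_run (by decide) σ
  have h6 : (levelProg.run σ).reg 6 = σ.reg 6 := reg_run (by decide) σ
  have h7 : (levelProg.run σ).reg 7 = σ.reg 7 := reg_run (by decide) σ
  rw [considerNext, run_seq]
  generalize levelProg.run σ = τ at *
  generalize hL : level (σ.arr 0) (σ.arr 1) (σ.arr 4) (σ.reg 0) = L at *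
  obtain ⟨hm, hle⟩ := h
  rw [hL] at hm hle
  rcases run_ite _ _ _ τ with ⟨hc, hr⟩ | ⟨hc, hr⟩ <;> rw [hr] <;>
    simp only [ne_eq, val_and, val_or, val_not, val_lt, val_ne, val, h1, h2, h5, h6, h7] at hc
  · rw [run_skip, h7]
    constructor
    · intro h0; rw [hL]; exact ⟨Or.inl (hm h0).1, (hm h0).2⟩
    · rw [hL]
      rintro x (hx | rfl) h0 h0'
      · exact hle x hx h0 h0'
      · omega
  · simp only [run_assign, val, reg_setReg_self, h1]
    constructor
    · intro h0; rw [hL]; exact ⟨Or.inr rfl, by omega⟩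
    · rw [hL]
      rintro x (hx | rfl) h0 h0'
      · have := hle x hx h0 h0'; omega
      · omega

theorem findNext_spec (σ : State) :
    NextSpec (σ.arr 0) (σ.arr 1) (σ.arr 4) (σ.reg 0)
      (IsEndpoint (σ.arr 0) (σ.arr 1) (σ.reg 0))
      (σ.reg 5) (σ.reg 6) ((findNext.run σ).reg 7) := by
  rw [findNext, run_seq, run_assign]
  refine forN_induction (p := findNextBody) (σ := σ.setReg 7 _) (c := 4)
    (fun k υ => NextSpec (σ.arr 0) (σ.arr 1) (σ.arr 4) (σ.reg 0)
      (IsEndpoint (σ.arr 0) (σ.arr 1) k) (σ.reg 5) (σ.reg 6) (υ.reg 7))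
    (by decide) ⟨fun h => absurd rfl h, fun x ⟨s, hs, _⟩ => absurd hs (Nat.not_lt_zero s)⟩
    fun k υ hk h4 hr ha h => ?_
  have h0 : υ.reg 0 = σ.reg 0 := hr 0 (by decide) (by decide)
  have h5 : υ.reg 5 = σ.reg 5 := hr 5 (by decide) (by decide)
  have h6 : υ.reg 6 = σ.reg 6 := hr 6 (by decide) (by decide)
  have ha0 : υ.arr 0 = σ.arr 0 := ha 0 (by decide)
  have ha1 : υ.arr 1 = σ.arr 1 := ha 1 (by decide)
  have ha4 : υ.arr 4 = σ.arr 4 := ha 4 (by decide)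
  have s1 := considerNext_spec (υ.setReg 1 (υ.arr 0 (υ.reg 4))) (IsEndpoint (σ.arr 0) (σ.arr 1) k)
    (by simpa only [arr_setReg, ha0, ha1, ha4, h0, h5, h6, reg_setReg_of_ne (show 0 ≠ 1 by decide),
      reg_setReg_of_ne (show 5 ≠ 1 by decide), reg_setReg_of_ne (show 6 ≠ 1 by decide),
      reg_setReg_of_ne (show 7 ≠ 1 by decide)] using h)
  set υ' := considerNext.run (υ.setReg 1 (υ.arr 0 (υ.reg 4))) with hυ'
  have g0 : υ'.reg 0 = σ.reg 0 := (reg_run (by decide) _).trans h0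
  have g4 : υ'.reg 4 = k := (reg_run (by decide) _).trans h4
  have g5 : υ'.reg 5 = σ.reg 5 := (reg_run (by decide) _).trans h5
  have g6 : υ'.reg 6 = σ.reg 6 := (reg_run (by decide) _).trans h6
  have ga0 : υ'.arr 0 = σ.arr 0 := (arr_run (by decide) _).trans ha0
  have ga1 : υ'.arr 1 = σ.arr 1 := (arr_run (by decide) _).trans ha1
  have ga4 : υ'.arr 4 = σ.arr 4 := (arr_run (by decide) _).trans ha4
  simp only [arr_setReg, ha0, ha1, ha4, reg_setReg_self, h4, h0, h5, h6,
    reg_setReg_of_ne (show 0 ≠ 1 by decide), reg_setReg_of_ne (show 5 ≠ 1 by decide),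
    reg_setReg_of_ne (show 6 ≠ 1 by decide)] at s1
  have s2 := considerNext_spec (υ'.setReg 1 (υ'.arr 1 (υ'.reg 4)))
    (fun x => IsEndpoint (σ.arr 0) (σ.arr 1) k x ∨ x = σ.arr 0 k)
    (by simpa only [arr_setReg, ga0, ga1, ga4, g0, g5, g6, reg_setReg_of_ne (show 0 ≠ 1 by decide),
      reg_setReg_of_ne (show 5 ≠ 1 by decide), reg_setReg_of_ne (show 6 ≠ 1 by decide),
      reg_setReg_of_ne (show 7 ≠ 1 by decide)] using s1)
  simp only [arr_setReg, ga0, ga1, ga4, reg_setReg_self, g4, g0, g5, g6,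
    reg_setReg_of_ne (show 0 ≠ 1 by decide), reg_setReg_of_ne (show 5 ≠ 1 by decide),
    reg_setReg_of_ne (show 6 ≠ 1 by decide)] at s2
  have hrun : findNextBody.run υ = considerNext.run (υ'.setReg 1 (σ.arr 1 k)) := by
    rw [findNextBody, run_seq, run_seq, run_seq, run_assign, run_assign, Exp.val, Exp.val, Exp.val,
      ← hυ', Exp.val, g4, ga1]
  rw [reg_setReg_of_ne (show 7 ≠ 4 by decide), hrun,
    isEndpoint_succ]
  exact s2

/-- A linear scan keeps the best candidate so far. Replacing `b` by a better `c` must not revive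
candidates already beaten, which is what `trans` provides. -/
theorem select_spec (σ : State) (t : Exp) (better : ℕ → ℕ → Prop)
    (irrefl : ∀ s, ¬ better s s) (trans : ∀ s b c, ¬ better s b → better c b → ¬ better s c)
    (ht : ∀ τ : State, τ.arr 0 = σ.arr 0 → τ.arr 1 = σ.arr 1 →
      (t.val τ = 0 ↔ ¬ better (τ.reg 3) (τ.reg 9 - 1))) :
    IsBest (σ.arr 0) (σ.arr 1) (σ.arr 4) (σ.reg 0) (σ.reg 1) better
      (((select t).run σ).reg 9) := by
  let τ := σ.setReg 9 0
  refine forN_induction (σ := τ) (c := 3)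
    (fun k υ => IsBest (σ.arr 0) (σ.arr 1) (σ.arr 4) k (σ.reg 1) better (υ.reg 9))
    (by simp [regs]) ⟨fun _ s hs => absurd hs (Nat.not_lt_zero s), fun h => absurd rfl h⟩
    fun k υ hk h3 hr ha h => ?_
  have h1 : υ.reg 1 = σ.reg 1 := hr 1 (by decide) (by simp [regs])
  have ha0 : υ.arr 0 = σ.arr 0 := ha 0 (by simp [arrs])
  have ha1 : υ.arr 1 = σ.arr 1 := ha 1 (by simp [arrs])
  have ha4 : υ.arr 4 = σ.arr 4 := ha 4 (by simp [arrs])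
  rw [reg_setReg_of_ne (by decide)]
  obtain ⟨hn, hs⟩ := h
  rcases run_ite _ _ _ υ with ⟨hc, hr⟩ | ⟨hc, hr⟩ <;> rw [hr] <;>
    simp only [ne_eq, val_and, val_or, val_not, val_lt, val_le, val_eq, val, h1, h3, ha0, ha1, ha4,
      ht υ ha0 ha1] at hc
  · rw [run_skip]
    constructor
    · intro hB s hsk he
      rcases Nat.lt_succ_iff_lt_or_eq.1 hsk with hsk | rfl
      · exact hn hB s hsk he
      · omega
    · intro hB
      obtain ⟨g1, g2, g3, g4, g5⟩ := hs hB
      refine ⟨by omega, g2, g3, g4, fun s hsk he hl hr => ?_⟩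
      rcases Nat.lt_succ_iff_lt_or_eq.1 hsk with hsk | rfl
      · exact g5 s hsk he hl hr
      · rcases hc with hc | hc
        · omega
        · exact hc.2
  · simp only [run_assign, val, reg_setReg_self, h3]
    push Not at hc
    obtain ⟨⟨c1, c2, c3⟩, c4⟩ := hc
    refine ⟨fun h => by omega, fun _ => ?_⟩
    rw [Nat.add_sub_cancel]
    refine ⟨by omega, c1, c2, c3, fun s hsk he hl hr => ?_⟩
    rcases Nat.lt_succ_iff_lt_or_eq.1 hsk with hsk | rfl
    · by_cases hB : υ.reg 9 = 0
      · exact absurd ⟨hl, hr⟩ (hn hB s hsk he)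
      · exact trans s _ k ((hs hB).2.2.2.2 s hsk he hl hr) (c4 hB)
    · exact irrefl s

theorem select_betterRight_spec (σ : State) :
    IsBest (σ.arr 0) (σ.arr 1) (σ.arr 4) (σ.reg 0) (σ.reg 1) (BetterRight (σ.arr 0) (σ.arr 1))
      (((select betterRight).run σ).reg 9) := by
  refine select_spec σ _ _ (fun s => ?_) (fun s b c => ?_) fun τ h0 h1 => ?_
  · unfold BetterRight; omega
  · unfold BetterRight; omega
  · simp only [betterRight, BetterRight, val_or, val_and, val_lt, val_eq, val, h0, h1]; omega

theorem select_betterLeft_spec (σ : State) :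
    IsBest (σ.arr 0) (σ.arr 1) (σ.arr 4) (σ.reg 0) (σ.reg 1) (BetterLeft (σ.arr 0) (σ.arr 1))
      (((select betterLeft).run σ).reg 9) := by
  refine select_spec σ _ _ (fun s => ?_) (fun s b c => ?_) fun τ h0 h1 => ?_
  · unfold BetterLeft; omega
  · unfold BetterLeft; omega
  · simp only [betterLeft, BetterLeft, val_or, val_and, val_lt, val_eq, val, h0, h1]; omega

theorem choose_spec (σ : State) :
    IsChoice (σ.arr 0) (σ.arr 1) (σ.arr 4) (σ.reg 0) (σ.reg 6) (σ.reg 7)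
      ((choose.run σ).reg 9) := by
  have h2 := reg_levelProg (σ.setReg 1 (σ.reg 6 - 1))
  have f : ∀ (τ : State) r, r ∉ levelProg.regs → (levelProg.run τ).reg r = τ.reg r :=
    fun τ r h => reg_run h τ
  have g : ∀ (τ : State) a, (levelProg.run τ).arr a = τ.arr a :=
    fun τ a => arr_run (by simp [levelProg, arrs]) τ
  simp only [choose, run_seq, run_assign, val]
  set τ := levelProg.run (σ.setReg 1 (σ.reg 6 - 1)) with hτ
  have t0 : τ.reg 0 = σ.reg 0 := (f _ 0 (by decide))
  have t6 : τ.reg 6 = σ.reg 6 := (f _ 6 (by decide))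
  have t7 : τ.reg 7 = σ.reg 7 := (f _ 7 (by decide))
  have ta : ∀ a, τ.arr a = σ.arr a := fun a => g _ a
  rw [reg_setReg_of_ne (show 7 ≠ 8 by decide), t7]
  set υ := (τ.setReg 8 (τ.reg 2)).setReg 1 (σ.reg 7) with hυ
  have h3 := reg_levelProg υ
  set ω := levelProg.run υ with hω
  have w0 : ω.reg 0 = σ.reg 0 := (f _ 0 (by decide)).trans t0
  have w6 : ω.reg 6 = σ.reg 6 := (f _ 6 (by decide)).trans t6
  have w7 : ω.reg 7 = σ.reg 7 := (f _ 7 (by decide)).trans t7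
  have w8 : ω.reg 8 = τ.reg 2 := (f _ 8 (by decide))
  have wa : ∀ a, ω.arr a = σ.arr a := fun a => (g _ a).trans (ta a)
  have u1 : υ.reg 1 = σ.reg 7 := rfl
  have u0 : υ.reg 0 = σ.reg 0 := t0
  have ua : ∀ a, υ.arr a = σ.arr a := ta
  rw [u0, u1, ua, ua, ua] at h3
  change τ.reg 2 = level (σ.arr 0) (σ.arr 1) (σ.arr 4) (σ.reg 0) (σ.reg 6 - 1) at h2
  rcases run_ite _ _ _ ω with ⟨hc, hr⟩ | ⟨hc, hr⟩ <;> rw [hr] <;>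
    simp only [ne_eq, val_le, val, w8, h2, h3] at hc <;>
    simp only [run_seq, run_assign, val, w6, w7]
  · right
    refine ⟨by omega, ?_⟩
    have := select_betterLeft_spec (ω.setReg 1 (σ.reg 7 - 1))
    simpa only [arr_setReg, wa, reg_setReg_self, reg_setReg_of_ne (show 0 ≠ 1 by decide), w0]
      using this
  · left
    refine ⟨by omega, ?_⟩
    have := select_betterRight_spec (ω.setReg 1 (σ.reg 6))
    simpa only [arr_setReg, wa, reg_setReg_self, reg_setReg_of_ne (show 0 ≠ 1 by decide), w0]
      using this

end RAM.ForProg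

/-! ### From gaps and choices to greedy decisions. -/

namespace RSC

section

variable {l r d e st : ℕ → ℕ} {n : ℕ}

theorem le_level {s x : ℕ} (hs : s < n) (hl : l s ≤ x) (hr : x < r s) : e s ≤ level l r e n x := by
  have : _ ≤ level l r e n x :=
    Finset.le_sup (f := fun s => if l s ≤ x ∧ x < r s then e s else 0) (Finset.mem_range.2 hs)
  simpa only [hl, hr, and_self, if_true] using this

theorem exists_eq_level {x : ℕ} (h : level l r e n x ≠ 0) :
    ∃ s < n, l s ≤ x ∧ x < r s ∧ e s = level l r e n x := by
  have hn : (Finset.range n).Nonempty := by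
    by_contra hn
    rw [Finset.not_nonempty_iff_eq_empty] at hn
    exact h (by simp [level, hn])
  obtain ⟨s, hs, hx⟩ := Finset.exists_mem_eq_sup _ hn fun s => if l s ≤ x ∧ x < r s then e s else 0
  change level l r e n x = _ at hx
  rw [Finset.mem_range] at hs
  split_ifs at hx with hc
  · exact ⟨s, hs, hc.1, hc.2, hx.symm⟩
  · exact absurd hx h

theorem level_congr {e' : ℕ → ℕ} {x x' : ℕ} (h : ∀ s < n, (if l s ≤ x ∧ x < r s then e s else 0) =
    if l s ≤ x' ∧ x' < r s then e' s else 0) : level l r e n x = level l r e' n x' :=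
  Finset.sup_congr rfl fun s hs => h s (Finset.mem_range.1 hs)

/-- No endpoint lies strictly after the greatest endpoint `p ≤ x` and up to `x`, so the same sensors
are live at `p` and at `x`. Hence searching the endpoints suffices, whatever the size of the
coordinates. -/
theorem exists_endpoint_level_eq {q x : ℕ} (hq : IsEndpoint l r n q) (hqx : q ≤ x) :
    ∃ p, IsEndpoint l r n p ∧ q ≤ p ∧ p ≤ x ∧ level l r e n p = level l r e n x := by
  classical
  let p := Nat.findGreatest (IsEndpoint l r n) x
  have hp : IsEndpoint l r n p := Nat.findGreatest_spec hqx hq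
  have hpx : p ≤ x := Nat.findGreatest_le x
  have hmax : ∀ y, IsEndpoint l r n y → y ≤ x → y ≤ p := fun y hy hyx =>
    Nat.le_findGreatest hyx hy
  refine ⟨p, hp, hmax q hq hqx, hpx, level_congr fun s hs => ?_⟩
  have h1 := hmax (l s) ⟨s, hs, .inl rfl⟩
  have h2 := hmax (r s) ⟨s, hs, .inr rfl⟩
  split_ifs <;> omega

/-- `[i, j)` is a maximal interval on which the level is equal to its minimum `m` over the region
to be covered. -/
structure IsGap (l r e : ℕ → ℕ) (n m i j : ℕ) : Prop where
  pos : m ≠ 0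
  min : ∀ x, level l r e n x ≠ 0 → m ≤ level l r e n x
  lt : i < j
  level_eq : ∀ x, i ≤ x → x < j → level l r e n x = m
  left : i ≠ 0 → level l r e n (i - 1) ≠ m
  right : level l r e n j ≠ m

theorem isGap_of_spec {m i j : ℕ} (hn : 0 < n) (hlr : ∀ s < n, l s < r s) (he : ∀ s < n, e s ≠ 0)
    (hi : MinSpec l r e n (IsEndpoint l r n) m i)
    (hj : NextSpec l r e n (IsEndpoint l r n) m i j) : IsGap l r e n m i j := by
  have key : ∀ x, level l r e n x ≠ 0 →
      ∃ p, IsEndpoint l r n p ∧ p ≤ x ∧ level l r e n p = level l r e n x := by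
    intro x hx
    obtain ⟨s, hs, hl, hr, -⟩ := exists_eq_level hx
    obtain ⟨p, hp, -, hpx, h⟩ := exists_endpoint_level_eq (e := e) ⟨s, hs, .inl rfl⟩ hl
    exact ⟨p, hp, hpx, h⟩
  have hm : m ≠ 0 := by
    have h1 := le_level (e := e) hn (le_refl (l 0)) (hlr 0 hn)
    have h2 := he 0 hn
    exact (hi.le (l 0) ⟨0, hn, .inl rfl⟩ (by omega)).1
  obtain ⟨hiE, him⟩ := hi.mem hm
  -- The largest right endpoint has level 0, so the search for the end of the gap succeeds.
  have hj0 : j ≠ 0 := by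
    obtain ⟨a, ha, has⟩ := Finset.exists_mem_eq_sup (Finset.range n) ⟨0, by simpa using hn⟩ r
    have hmax : ∀ s < n, r s ≤ r a := fun s hs => by
      rw [← has]; exact Finset.le_sup (Finset.mem_range.2 hs)
    have h0 : level l r e n (r a) = 0 := by
      by_contra h
      obtain ⟨s, hs, h1, h2, -⟩ := exists_eq_level h
      have := hmax s hs
      omega
    obtain ⟨s, hs, h1, h2, -⟩ := exists_eq_level (him.trans_ne hm)
    have := hmax s hs
    exact (hj.le (r a) ⟨a, Finset.mem_range.1 ha, .inr rfl⟩ (by omega) (by omega)).1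
  obtain ⟨hjE, hij, hjm⟩ := hj.mem hj0
  refine ⟨hm, fun x hx => ?_, hij, fun x hix hxj => ?_, fun hi0 h => ?_, hjm⟩
  · obtain ⟨p, hp, -, hpx⟩ := key x hx
    rw [← hpx] at hx ⊢
    exact (hi.le p hp hx).2.1
  · obtain ⟨p, hp, hip, hpx, h⟩ := exists_endpoint_level_eq (e := e) hiE hix
    rw [← h]
    by_contra hne
    have hne' : p ≠ i := by rintro rfl; exact hne him
    have := (hj.le p hp (by omega) hne).2
    omega
  · obtain ⟨p, hp, hpi, hpx⟩ := key (i - 1) (h.trans_ne hm)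
    rw [h] at hpx
    have := (hi.le p hp (hpx.trans_ne hm)).2.2 hpx
    omega

/-- One decision of the greedy algorithm: sensor `idx` is started at time `start` for the gap
`[lo, hi)`, with preference for sensors that reach far to the right if `right` holds, and to the
left otherwise. -/
structure Decision where
  idx : ℕ
  start : ℕ
  lo : ℕ
  hi : ℕ
  right : Prop

/-- Decision `G k` is greedy after the decisions `G a` with `a < k`. -/
structure IsGreedy (l r d : ℕ → ℕ) (n : ℕ) (G : ℕ → Decision) (k : ℕ) : Prop where
  idx_lt : (G k).idx < n
  fresh : ∀ a < k, (G a).idx ≠ (G k).idx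
  lt : (G k).lo < (G k).hi
  mono : ∀ a < k, (G a).start ≤ (G k).start
  free : ∀ a < k, ∀ p, (G k).lo ≤ p → p < (G k).hi → l (G a).idx ≤ p → p < r (G a).idx →
    (G a).start + d (G a).idx ≤ (G k).start
  memR : (G k).right → l (G k).idx ≤ (G k).lo ∧ (G k).lo < r (G k).idx
  domR : (G k).right → ∀ s < n, (∀ a ≤ k, (G a).idx ≠ s) → l s ≤ (G k).lo → (G k).lo < r s →
    ¬ BetterRight l r s (G k).idx
  nbrR : (G k).right → (G k).hi < r (G k).idx → (G k).lo ≠ 0 ∧ ∃ z < k, ∃ B < k,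
    l (G z).idx ≤ (G k).lo - 1 ∧ (G k).lo - 1 < r (G z).idx ∧
    l (G B).idx ≤ (G k).hi ∧ (G k).hi < r (G B).idx ∧
    (G k).start < (G B).start + d (G B).idx ∧
    ∀ b < k, l (G b).idx ≤ (G k).hi → (G k).hi < r (G b).idx →
      (G b).start + d (G b).idx ≤ (G z).start + d (G z).idx
  memL : ¬ (G k).right → l (G k).idx ≤ (G k).hi - 1 ∧ (G k).hi - 1 < r (G k).idx
  domL : ¬ (G k).right → ∀ s < n, (∀ a ≤ k, (G a).idx ≠ s) → l s ≤ (G k).hi - 1 →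
    (G k).hi - 1 < r s → ¬ BetterLeft l r s (G k).idx
  nbrL : ¬ (G k).right → l (G k).idx < (G k).lo → ∃ z < k, ∃ B < k,
    l (G z).idx ≤ (G k).hi ∧ (G k).hi < r (G z).idx ∧
    l (G B).idx ≤ (G k).lo - 1 ∧ (G k).lo - 1 < r (G B).idx ∧
    (G k).start < (G B).start + d (G B).idx ∧
    ∀ b < k, l (G b).idx ≤ (G k).lo - 1 → (G k).lo - 1 < r (G b).idx →
      (G b).start + d (G b).idx ≤ (G z).start + d (G z).idx

theorem IsGreedy.congr {G G' : ℕ → Decision} {k : ℕ} (h : IsGreedy l r d n G k)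
    (hG : ∀ a ≤ k, G' a = G a) : IsGreedy l r d n G' k := by
  have hk := hG k le_rfl
  have hlt : ∀ a < k, G' a = G a := fun a ha => hG a ha.le
  constructor
  · rw [hk]; exact h.idx_lt
  · intro a ha; rw [hk, hlt a ha]; exact h.fresh a ha
  · rw [hk]; exact h.lt
  · intro a ha; rw [hk, hlt a ha]; exact h.mono a ha
  · intro a ha; rw [hk, hlt a ha]; exact h.free a ha
  · rw [hk]; exact h.memR
  · rw [hk]; exact fun hR s hs ha => h.domR hR s hs fun a hak => hG a hak ▸ ha a hak
  · rw [hk]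
    intro hR hhi
    obtain ⟨h0, z, hz, B, hB, h1, h2, h3, h4, h5, h6⟩ := h.nbrR hR hhi
    refine ⟨h0, z, hz, B, hB, ?_⟩
    rw [hlt z hz, hlt B hB]
    exact ⟨h1, h2, h3, h4, h5, fun b hb => by rw [hlt b hb]; exact h6 b hb⟩
  · rw [hk]; exact h.memL
  · rw [hk]; exact fun hR s hs ha => h.domL hR s hs fun a hak => hG a hak ▸ ha a hak
  · rw [hk]
    intro hR hhi
    obtain ⟨z, hz, B, hB, h1, h2, h3, h4, h5, h6⟩ := h.nbrL hR hhi
    refine ⟨z, hz, B, hB, ?_⟩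
    rw [hlt z hz, hlt B hB]
    exact ⟨h1, h2, h3, h4, h5, fun b hb => by rw [hlt b hb]; exact h6 b hb⟩

/-- The combinatorial record of greedy decisions. -/
def runOfGreedy {G : ℕ → Decision} {K : ℕ} (h : ∀ k < K, IsGreedy l r d n G k) : Run K where
  l k := l (G k).idx
  r k := r (G k).idx
  i k := (G k).lo
  j k := (G k).hi
  m k := (G k).start
  e k := (G k).start + d (G k).idx
  R k := (G k).right
  lt k hk := by have := (h k hk).lt; omega
  mono k hk := (h k hk).mono
  free k hk a ha p h1 h2 h3 h4 :=
    (h k hk).free a ha p.toNat (by omega) (by omega) (by omega) (by omega)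
  memR k hk hR := by have := (h k hk).memR hR; omega
  domR b hb a hab hR h1 h2 := by
    -- The sensor of the later decision `b` was still available when decision `a` was taken, so it
    -- was among the candidates.
    have hfresh : ∀ c ≤ a, (G c).idx ≠ (G b).idx := fun c hc => (h b hb).fresh c (by omega)
    have := (h a (by omega)).domR hR _ (h b hb).idx_lt hfresh (by omega) (by omega)
    unfold BetterRight at this
    omega
  nbrR k hk hR hhi := by
    obtain ⟨h0, z, hz, B, hB, h1, h2, h3, h4, h5, h6⟩ := (h k hk).nbrR hR (by omega)
    exact ⟨z, hz, B, hB, by omega, by omega, by omega, by omega, h5,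
      fun b hb g1 g2 => h6 b hb (by omega) (by omega)⟩
  memL k hk hR := by have := (h k hk).memL hR; have := (h k hk).lt; omega
  domL b hb a hab hR h1 h2 := by
    have hfresh : ∀ c ≤ a, (G c).idx ≠ (G b).idx := fun c hc => (h b hb).fresh c (by omega)
    have := (h a (by omega)).domL hR _ (h b hb).idx_lt hfresh (by omega) (by omega)
    unfold BetterLeft at this
    omega
  nbrL k hk hR hlo := by
    obtain ⟨z, hz, B, hB, h1, h2, h3, h4, h5, h6⟩ := (h k hk).nbrL hR (by omega)
    exact ⟨z, hz, B, hB, by omega, by omega, by omega, by omega, h5,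
      fun b hb g1 g2 => h6 b hb (by omega) (by omega)⟩

/-- The stop times plus one `e` and the start times `st` result from `K` greedy decisions `G`. -/
structure Tracks (l r d : ℕ → ℕ) (n : ℕ) (e st : ℕ → ℕ) (G : ℕ → Decision) (K : ℕ) : Prop where
  greedy : ∀ k < K, IsGreedy l r d n G k
  stopTime : ∀ k < K, e (G k).idx = (G k).start + d (G k).idx + 1
  start : ∀ k < K, st (G k).idx = (G k).start
  unscheduled : ∀ s < n, (∀ k < K, (G k).idx ≠ s) → e s = 1
  start_lt : ∀ k < K, ∀ x, level l r e n x ≠ 0 → (G k).start < level l r e n x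
  covered : ∀ x y, y + 1 < level l r e n x →
    ∃ s < n, e s ≠ 1 ∧ l s ≤ x ∧ x < r s ∧ st s ≤ y ∧ y < st s + d s

variable {G : ℕ → Decision} {K : ℕ}

theorem Tracks.ne_zero (h : Tracks l r d n e st G K) {s : ℕ} (hs : s < n) : e s ≠ 0 := by
  by_cases hk : ∀ k < K, (G k).idx ≠ s
  · rw [h.unscheduled s hs hk]; exact one_ne_zero
  · push Not at hk
    obtain ⟨k, hk, rfl⟩ := hk
    rw [h.stopTime k hk]; exact Nat.succ_ne_zero _

theorem Tracks.exists_of_ne_one (h : Tracks l r d n e st G K) {s : ℕ} (hs : s < n) (he : e s ≠ 1) :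
    ∃ k < K, (G k).idx = s := by
  by_contra hk
  push Not at hk
  exact he (h.unscheduled s hs hk)

theorem level_update {b v x : ℕ} (hb : b < n) (hv : e b ≤ v) :
    level l r (Function.update e b v) n x =
      if l b ≤ x ∧ x < r b then max v (level l r e n x) else level l r e n x := by
  split_ifs with h
  · apply le_antisymm
    · refine Finset.sup_le fun s hs => ?_
      rw [Finset.mem_range] at hs
      split_ifs with hx
      · rcases eq_or_ne s b with rfl | hsb
        · rw [Function.update_self]; exact le_max_left _ _
        · rw [Function.update_of_ne hsb]
          exact (le_level hs hx.1 hx.2).trans (le_max_right _ _)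
      · exact Nat.zero_le _
    · refine max_le ?_ (Finset.sup_mono_fun fun s hs => ?_)
      · simpa using le_level (e := Function.update e b v) hb h.1 h.2
      · rcases eq_or_ne s b with rfl | hsb
        · rw [Function.update_self]; split_ifs
          all_goals omega
        · rw [Function.update_of_ne hsb]
  · refine level_congr fun s hs => ?_
    rcases eq_or_ne s b with rfl | hsb
    · simp only [h, if_false]
    · rw [Function.update_of_ne hsb]

/-- Starting the chosen sensor at time `m - 1`, exactly when coverage of the gap ends, leaves no
interruption: elsewhere on the sensor coverage already lasts at least that long. -/
theorem Tracks.step (h : Tracks l r d n e st G K) (hd : ∀ s < n, 0 < d s) {m i j B : ℕ}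
    (hg : IsGap l r e n m i j) (hc : IsChoice l r e n i j B) (hB : B ≠ 0) :
    B - 1 < n ∧ e (B - 1) = 1 ∧ ∃ G', Tracks l r d n (Function.update e (B - 1) (m + d (B - 1)))
      (Function.update st (B - 1) (m - 1)) G' (K + 1) := by
  classical
  set R : Prop := level l r e n j ≤ level l r e n (i - 1) ∧ IsBest l r e n i (BetterRight l r) B
    with hR
  have hL : ¬ R → level l r e n (i - 1) ≤ level l r e n j ∧
    IsBest l r e n (j - 1) (BetterLeft l r) B := fun h => hc.resolve_left h
  have hb : B - 1 < n ∧ e (B - 1) = 1 := by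
    by_cases hR' : R
    · exact ⟨(hR'.2.some hB).1, (hR'.2.some hB).2.1⟩
    · exact ⟨((hL hR').2.some hB).1, ((hL hR').2.some hB).2.1⟩
  refine ⟨hb.1, hb.2, ?_⟩
  obtain ⟨hbn, hb1⟩ := hb
  generalize hBb : B - 1 = b at hbn hb1
  have hm := hg.pos
  have hij := hg.lt
  let new : Decision := ⟨b, m - 1, i, j, R⟩
  let G' := Function.update G K new
  have hGK : G' K = new := Function.update_self ..
  have hG : ∀ a < K, G' a = G a := fun a ha => Function.update_of_ne ha.ne _ _
  -- Durations are positive, so a scheduled sensor has `e ≥ 2` and is told apart from an unscheduled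
  -- one.
  have hidx : ∀ a < K, (G a).idx ≠ b := by
    rintro a ha rfl
    have := h.stopTime a ha
    have := hd _ hbn
    omega
  -- On the chosen sensor the level is positive, so outside level `m` it exceeds the minimum.
  have big : ∀ x, l b ≤ x → x < r b → level l r e n x ≠ m → m < level l r e n x := fun x h1 h2 h3 => by
    have := le_level (e := e) hbn h1 h2
    have := hg.min x (by omega)
    omega
  have attain : ∀ x, m < level l r e n x → ∃ z < K, l (G z).idx ≤ x ∧ x < r (G z).idx ∧
      (G z).start + d (G z).idx + 1 = level l r e n x := fun x hx => by
    obtain ⟨s, hs, h1, h2, h3⟩ := exists_eq_level (show level l r e n x ≠ 0 by omega)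
    obtain ⟨z, hz, rfl⟩ := h.exists_of_ne_one hs (by omega)
    exact ⟨z, hz, h1, h2, by rw [← h3, h.stopTime z hz]⟩
  have stopTime_le : ∀ a < K, ∀ x, l (G a).idx ≤ x → x < r (G a).idx →
      (G a).start + d (G a).idx + 1 ≤ level l r e n x := fun a ha x h1 h2 => by
    rw [← h.stopTime a ha]; exact le_level (h.greedy a ha).idx_lt h1 h2
  have unsch : ∀ s < n, (∀ a ≤ K, (G' a).idx ≠ s) → e s = 1 := fun s hs ha =>
    h.unscheduled s hs fun k hk => hG k hk ▸ ha k hk.le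
  have hnew : IsGreedy l r d n G' K := by
    constructor
    · rw [hGK]; exact hbn
    · intro a ha; rw [hGK, hG a ha]; exact hidx a ha
    · rw [hGK]; exact hij
    · intro a ha
      rw [hGK, hG a ha]
      have h1 := hg.level_eq i le_rfl hij
      have := h.start_lt a ha i (by omega)
      simp only [new]; omega
    · intro a ha p
      rw [hGK, hG a ha]
      intro h1 h2 h3 h4
      have := hg.level_eq p h1 h2
      have := stopTime_le a ha p h3 h4
      simp only [new]; omega
    · rw [hGK]
      intro hR'
      have := hR'.2.some hB
      rw [hBb] at this
      exact ⟨this.2.2.1, this.2.2.2.1⟩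
    · intro hR' s hs ha
      have := unsch s hs ha
      rw [hGK] at hR' ⊢
      have h1 := (hR'.2.some hB).2.2.2.2 s hs this
      rwa [hBb] at h1
    · rw [hGK]
      intro hR' hhi
      change j < r b at hhi
      have h1 := hR'.2.some hB
      rw [hBb] at h1
      have h2 := big j (by omega) hhi hg.right
      have h3 := hR'.1
      -- For `i = 0` the truncated `i - 1` is `0`, which has level `m`; the comparison would then
      -- bound the level at `j` by `m`.
      have hi0 : i ≠ 0 := by
        rintro rfl
        have := hg.level_eq 0 le_rfl hij
        simp only [Nat.zero_sub] at h3
        omega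
      obtain ⟨z, hz, z1, z2, z3⟩ := attain (i - 1) (by omega)
      obtain ⟨a, ha, a1, a2, a3⟩ := attain j h2
      refine ⟨hi0, z, hz, a, ha, ?_⟩
      rw [hG z hz, hG a ha]
      refine ⟨z1, z2, a1, a2, by simp only [new]; omega, fun c hc c1 c2 => ?_⟩
      rw [hG c hc] at c1 c2 ⊢
      have := stopTime_le c hc j c1 c2
      omega
    · rw [hGK]
      intro hR'
      have := (hL hR').2.some hB
      rw [hBb] at this
      exact ⟨this.2.2.1, this.2.2.2.1⟩
    · intro hR' s hs ha
      have := unsch s hs ha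
      rw [hGK] at hR' ⊢
      have h1 := ((hL hR').2.some hB).2.2.2.2 s hs this
      rwa [hBb] at h1
    · rw [hGK]
      intro hR' hlo
      change l b < i at hlo
      have h1 := (hL hR').2.some hB
      rw [hBb] at h1
      have h2 := big (i - 1) (by omega) (by omega) (hg.left (by omega))
      have h3 := (hL hR').1
      obtain ⟨z, hz, z1, z2, z3⟩ := attain j (by omega)
      obtain ⟨a, ha, a1, a2, a3⟩ := attain (i - 1) h2
      refine ⟨z, hz, a, ha, ?_⟩
      rw [hG z hz, hG a ha]
      refine ⟨z1, z2, a1, a2, by simp only [new]; omega, fun c hc c1 c2 => ?_⟩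
      rw [hG c hc] at c1 c2 ⊢
      have := stopTime_le c hc (i - 1) c1 c2
      omega
  have hlev := fun x => level_update (l := l) (r := r) (e := e) (x := x) hbn
    (show e b ≤ m + d b by omega)
  have lev_ne : ∀ x, level l r (Function.update e b (m + d b)) n x ≠ 0 →
      level l r e n x ≠ 0 := fun x hx => by
    rw [hlev] at hx
    split_ifs at hx with hbx
    · have := le_level (e := e) hbn hbx.1 hbx.2; omega
    · exact hx
  have lev_le : ∀ x, level l r e n x ≤ level l r (Function.update e b (m + d b)) n x := fun x => by
    rw [hlev]; split_ifs <;> omega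
  refine ⟨G', ?_, ?_, ?_, ?_, ?_, ?_⟩
  · intro k hk
    rcases Nat.lt_succ_iff_lt_or_eq.1 hk with hk | rfl
    · exact (h.greedy k hk).congr fun a ha => hG a (by omega)
    · exact hnew
  · intro k hk
    rcases Nat.lt_succ_iff_lt_or_eq.1 hk with hk | rfl
    · rw [hG k hk, Function.update_of_ne (hidx k hk)]; exact h.stopTime k hk
    · rw [hGK]; simp only [new, Function.update_self]; omega
  · intro k hk
    rcases Nat.lt_succ_iff_lt_or_eq.1 hk with hk | rfl
    · rw [hG k hk, Function.update_of_ne (hidx k hk)]; exact h.start k hk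
    · rw [hGK]; simp only [new, Function.update_self]
  · intro s hs hk
    have hsb : s ≠ b := by
      have := hk K (Nat.lt_succ_self K); rw [hGK] at this; exact this.symm
    rw [Function.update_of_ne hsb]
    exact unsch s hs fun a ha => hk a (by omega)
  · intro k hk x hx
    have h1 := lev_le x
    have h2 := lev_ne x hx
    rcases Nat.lt_succ_iff_lt_or_eq.1 hk with hk | rfl
    · rw [hG k hk]
      exact (h.start_lt k hk x h2).trans_le h1
    · rw [hGK]
      have := hg.min x h2
      simp only [new]; omega
  · intro x y hy
    by_cases hyx : y + 1 < level l r e n x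
    · obtain ⟨s, hs, h0, h1⟩ := h.covered x y hyx
      -- The clause `e s ≠ 1` in `covered` ensures that changing the start time of `b` does not
      -- disturb existing coverage.
      have hsb : s ≠ b := by rintro rfl; exact h0 hb1
      exact ⟨s, hs, by rwa [Function.update_of_ne hsb], by rwa [Function.update_of_ne hsb]⟩
    · rw [hlev] at hy
      split_ifs at hy with hbx
      · have := hd b hbn
        refine ⟨b, hbn, by rw [Function.update_self]; omega, hbx.1, hbx.2, ?_⟩
        have := le_level (e := e) hbn hbx.1 hbx.2
        have := hg.min x (by omega)
        rw [Function.update_self]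
        omega
      · exact absurd hy hyx

end

end RSC

/-! ### Stuck points and the load there. -/

namespace RSC

section

variable {l r d e st : ℕ → ℕ} {n : ℕ} {G : ℕ → Decision} {K : ℕ}

/-- All sensors that are live at some point of smallest level are scheduled. -/
def Stuck (l r e : ℕ → ℕ) (n : ℕ) : Prop :=
  ∃ x, level l r e n x ≠ 0 ∧ (∀ x', level l r e n x' ≠ 0 → level l r e n x ≤ level l r e n x') ∧
    ∀ s < n, l s ≤ x → x < r s → e s ≠ 1

theorem IsGap.stuck {m i j : ℕ} (hg : IsGap l r e n m i j) (hc : IsChoice l r e n i j 0) :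
    Stuck l r e n := by
  have key : ∀ q, level l r e n q = m → (∀ s < n, e s = 1 → ¬ (l s ≤ q ∧ q < r s)) →
      Stuck l r e n := fun q hq h =>
    ⟨q, by rw [hq]; exact hg.pos, by rw [hq]; exact hg.min, fun s hs h1 h2 h3 => h s hs h3 ⟨h1, h2⟩⟩
  have hij := hg.lt
  rcases hc with ⟨-, h⟩ | ⟨-, h⟩
  · exact key i (hg.level_eq i le_rfl hij) (h.none rfl)
  · exact key (j - 1) (hg.level_eq _ (by omega) (by omega)) (h.none rfl)

/-- Further scheduling involves only unscheduled sensors. None of them is live at the stuck point,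
whose level therefore stays the same while other levels can only grow. -/
theorem Stuck.update (h : Stuck l r e n) {b v : ℕ} (hb : b < n) (hb1 : e b = 1) (hv : 1 ≤ v) :
    Stuck l r (Function.update e b v) n := by
  obtain ⟨x, hx, hmin, hs⟩ := h
  have hbx : ¬ (l b ≤ x ∧ x < r b) := fun h => hs b hb h.1 h.2 hb1
  have hlev := fun x => level_update (l := l) (r := r) (e := e) (v := v) (x := x) hb (by omega)
  refine ⟨x, ?_, fun x' hx' => ?_, fun s hsn h1 h2 => ?_⟩
  · rwa [hlev, if_neg hbx]
  · rw [hlev, if_neg hbx]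
    rw [hlev] at hx' ⊢
    split_ifs at hx' ⊢ with h
    · have := le_level (e := e) hb h.1 h.2
      exact (hmin x' (by omega)).trans (le_max_right _ _)
    · exact hmin x' hx'
  · rw [Function.update_of_ne (by rintro rfl; exact hbx ⟨h1, h2⟩)]
    exact hs s hsn h1 h2

/-- After `n` decisions with distinct indices below `n`, every sensor is scheduled, so any point of
smallest positive level will do. -/
theorem Tracks.stuck (h : Tracks l r d n e st G n) (hd : ∀ s < n, 0 < d s) (hn : 0 < n)
    (hlr : ∀ s < n, l s < r s) : Stuck l r e n := by
  classical
  have hne : ∃ v x, level l r e n x = v ∧ v ≠ 0 := by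
    have h1 := le_level (e := e) hn (le_refl (l 0)) (hlr 0 hn)
    have h2 := h.ne_zero hn
    exact ⟨_, l 0, rfl, by omega⟩
  obtain ⟨x, hx, hx0⟩ := Nat.find_spec hne
  refine ⟨x, by rwa [hx], fun x' hx' => hx ▸ Nat.find_min' hne ⟨x', rfl, hx'⟩, fun s hs _ _ => ?_⟩
  have hsurj : s ∈ (Finset.range n).image fun k => (G k).idx := by
    rw [Finset.eq_of_subset_of_card_le (s := (Finset.range n).image fun k => (G k).idx)
      (t := Finset.range n)]
    · exact Finset.mem_range.2 hs
    · intro a ha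
      obtain ⟨k, hk, rfl⟩ := Finset.mem_image.1 ha
      exact Finset.mem_range.2 (h.greedy k (Finset.mem_range.1 hk)).idx_lt
    · rw [Finset.card_image_of_injOn]
      intro a ha b hb hab
      rw [Finset.coe_range, Set.mem_Iio] at ha hb
      rcases lt_trichotomy a b with hlt | heq | hlt
      · exact absurd hab ((h.greedy b hb).fresh a hlt)
      · exact heq
      · exact absurd hab.symm ((h.greedy a ha).fresh b hlt)
  obtain ⟨k, hk, rfl⟩ := Finset.mem_image.1 hsurj
  have := h.stopTime k (Finset.mem_range.1 hk)
  have := hd _ hs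
  show e (G k).idx ≠ 1
  omega

/-- At a point of smallest level where all live sensors are scheduled, the load is at most seven
times the duration of the schedule. -/
theorem Tracks.load_le (h : Tracks l r d n e st G K) {x : ℕ}
    (hs : ∀ s < n, l s ≤ x → x < r s → e s ≠ 1) :
    ∑ s ∈ Finset.range n with l s ≤ x ∧ x < r s, d s ≤ 7 * (level l r e n x - 1) := by
  classical
  set T := level l r e n x - 1 with hT
  set A := (Finset.range n).filter fun s => l s ≤ x ∧ x < r s with hA
  have hmem : ∀ s ∈ A, ∃ k < K, (G k).idx = s ∧ l s ≤ x ∧ x < r s ∧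
      st s = (G k).start ∧ st s + d s ≤ T := by
    intro s hsA
    rw [hA, Finset.mem_filter, Finset.mem_range] at hsA
    obtain ⟨hsn, h1, h2⟩ := hsA
    obtain ⟨k, hk, rfl⟩ := h.exists_of_ne_one hsn (hs s hsn h1 h2)
    have := le_level (e := e) hsn h1 h2
    have := h.stopTime k hk
    have := h.start k hk
    exact ⟨k, hk, rfl, h1, h2, by omega, by omega⟩
  -- Each live sensor stops by time `T`, so its duration counts the integer times below `T` at which
  -- it is active. Exchanging the sums reduces the claim to the overlap bound at each time.
  have hdur : ∀ s ∈ A, d s = ∑ y ∈ Finset.range T, if st s ≤ y ∧ y < st s + d s then 1 else 0 := by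
    intro s hsA
    obtain ⟨k, -, -, -, -, -, hle⟩ := hmem s hsA
    rw [← Finset.card_filter]
    have : ((Finset.range T).filter fun y => st s ≤ y ∧ y < st s + d s) =
        Finset.Ico (st s) (st s + d s) := by
      ext y; simp only [Finset.mem_filter, Finset.mem_range, Finset.mem_Ico]; omega
    rw [this, Nat.card_Ico, Nat.add_sub_cancel_left]
  rw [Finset.sum_congr rfl hdur, Finset.sum_comm]
  calc ∑ y ∈ Finset.range T, ∑ s ∈ A, (if st s ≤ y ∧ y < st s + d s then 1 else 0)
      ≤ ∑ y ∈ Finset.range T, 7 := Finset.sum_le_sum fun y _ => ?_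
    _ = 7 * T := by rw [Finset.sum_const, Finset.card_range, smul_eq_mul, mul_comm]
  rw [← Finset.card_filter]
  refine le_trans ?_ ((runOfGreedy h.greedy).card_active_le (x : ℤ) y)
  refine le_trans (Finset.card_le_card ?_) (Finset.card_image_le (f := fun k => (G k).idx))
  intro s hsy
  rw [Finset.mem_filter] at hsy
  obtain ⟨k, hk, rfl, h1, h2, h3, -⟩ := hmem s hsy.1
  refine Finset.mem_image.2 ⟨k, Finset.mem_filter.2 ⟨Finset.mem_range.2 hk, ?_⟩, rfl⟩
  simp only [runOfGreedy]
  omega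

theorem tracks_init : Tracks l r d n (fun _ => 1) (fun _ => 0) (fun _ => ⟨0, 0, 0, 0, True⟩) 0 := by
  refine ⟨fun k hk => ?_, fun k hk => ?_, fun k hk => ?_, fun s _ _ => rfl, fun k hk => ?_,
    fun x y hy => ?_⟩
  iterate 4 exact absurd hk (Nat.not_lt_zero k)
  obtain ⟨s, -, -, -, h⟩ := exists_eq_level (show level l r (fun _ => 1) n x ≠ 0 by omega)
  omega

theorem Tracks.congr {e' st' : ℕ → ℕ} (h : Tracks l r d n e st G K) (he : ∀ s < n, e' s = e s)
    (hst : ∀ s < n, st' s = st s) : Tracks l r d n e' st' G K := by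
  have hlev : ∀ x, level l r e' n x = level l r e n x := fun x =>
    level_congr fun s hs => by rw [he s hs]
  refine ⟨h.greedy, fun k hk => ?_, fun k hk => ?_, fun s hs hk => ?_, fun k hk x => ?_,
    fun x y => ?_⟩
  · rw [he _ (h.greedy k hk).idx_lt]; exact h.stopTime k hk
  · rw [hst _ (h.greedy k hk).idx_lt]; exact h.start k hk
  · rw [he s hs]; exact h.unscheduled s hs hk
  · rw [hlev]; exact h.start_lt k hk x
  · rw [hlev]
    intro hy
    obtain ⟨s, hs, h1⟩ := h.covered x y hy
    exact ⟨s, hs, by rwa [he s hs, hst s hs]⟩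

end

end RSC

/-! ### The invariant of the main loop. -/

namespace RAM.ForProg

open Exp RSC

theorem schedule_spec (σ : State) :
    σ.reg 9 = 0 ∧ (schedule.run σ).arr = σ.arr ∨
    σ.reg 9 ≠ 0 ∧
      (schedule.run σ).arr 3 = Function.update (σ.arr 3) (σ.reg 9 - 1) (σ.reg 5 - 1) ∧
      (schedule.run σ).arr 4 =
        Function.update (σ.arr 4) (σ.reg 9 - 1) (σ.reg 5 + σ.arr 2 (σ.reg 9 - 1)) := by
  rcases run_ite (var 9) (seq (store 3 (sub (var 9) (lit 1)) (sub (var 5) (lit 1)))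
      (store 4 (sub (var 9) (lit 1)) (add (var 5) (get 2 (sub (var 9) (lit 1)))))) skip σ
    with ⟨hc, hr⟩ | ⟨hc, hr⟩
  · exact .inl ⟨by simpa [val] using hc, by rw [schedule, hr, run_skip]⟩
  · right
    rw [schedule, hr]
    refine ⟨by simpa [val] using hc, ?_, ?_⟩ <;> simp [run_seq, run_store, val, State.setArr, Function.update_of_ne]

/-- The invariant of the main loop. -/
def Inv (σ : State) (k : ℕ) (τ : State) : Prop :=
  ∃ G K, Tracks (σ.arr 0) (σ.arr 1) (σ.arr 2) (σ.reg 0) (τ.arr 4) (τ.arr 3) G K ∧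
    (K = k ∨ Stuck (σ.arr 0) (σ.arr 1) (τ.arr 4) (σ.reg 0))

/-- A pass either schedules a sensor or exhibits a stuck point. Later passes may still schedule
sensors elsewhere, which does no harm as stuck points persist. -/
theorem Inv.step {σ τ : State} {k : ℕ} (h : Inv σ k τ) (hn : 0 < σ.reg 0)
    (hlr : ∀ s < σ.reg 0, σ.arr 0 s < σ.arr 1 s) (hd : ∀ s < σ.reg 0, 0 < σ.arr 2 s)
    (h0 : τ.reg 0 = σ.reg 0) (ha0 : τ.arr 0 = σ.arr 0) (ha1 : τ.arr 1 = σ.arr 1)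
    (ha2 : τ.arr 2 = σ.arr 2) : Inv σ (k + 1) (greedyBody.run τ) := by
  obtain ⟨G, K, hT, hK⟩ := h
  rw [greedyBody, run_seq, run_seq, run_seq]
  set υ := findMin.run τ with hυ
  have hm : MinSpec _ _ _ _ _ (υ.reg 5) (υ.reg 6) := findMin_spec τ
  have u0 : υ.reg 0 = σ.reg 0 := (reg_run (by decide) _).trans h0
  have ua0 : υ.arr 0 = σ.arr 0 := (arr_run (by decide) _).trans ha0
  have ua1 : υ.arr 1 = σ.arr 1 := (arr_run (by decide) _).trans ha1
  have ua2 : υ.arr 2 = σ.arr 2 := (arr_run (by decide) _).trans ha2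
  have ua3 : υ.arr 3 = τ.arr 3 := arr_run (by decide) _
  have ua4 : υ.arr 4 = τ.arr 4 := arr_run (by decide) _
  have hj := findNext_spec υ
  set ω := findNext.run υ with hω
  have w0 : ω.reg 0 = σ.reg 0 := (reg_run (by decide) _).trans u0
  have w5 : ω.reg 5 = υ.reg 5 := reg_run (by decide) _
  have w6 : ω.reg 6 = υ.reg 6 := reg_run (by decide) _
  have wa0 : ω.arr 0 = σ.arr 0 := (arr_run (by decide) _).trans ua0
  have wa1 : ω.arr 1 = σ.arr 1 := (arr_run (by decide) _).trans ua1
  have wa2 : ω.arr 2 = σ.arr 2 := (arr_run (by decide) _).trans ua2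
  have wa3 : ω.arr 3 = τ.arr 3 := (arr_run (by decide) _).trans ua3
  have wa4 : ω.arr 4 = τ.arr 4 := (arr_run (by decide) _).trans ua4
  have hc := choose_spec ω
  set ψ := choose.run ω with hψ
  have p5 : ψ.reg 5 = υ.reg 5 := (reg_run (by decide) _).trans w5
  have pa2 : ψ.arr 2 = σ.arr 2 := (arr_run (by decide) _).trans wa2
  have pa3 : ψ.arr 3 = τ.arr 3 := (arr_run (by decide) _).trans wa3
  have pa4 : ψ.arr 4 = τ.arr 4 := (arr_run (by decide) _).trans wa4
  rw [h0, ha0, ha1] at hm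
  rw [u0, ua0, ua1, ua4] at hj
  rw [w0, wa0, wa1, wa4, w6] at hc
  have hg := isGap_of_spec hn hlr (fun s hs => hT.ne_zero hs) hm hj
  rcases schedule_spec ψ with ⟨hB, hr⟩ | ⟨hB, hr3, hr4⟩
  · rw [hB] at hc
    refine ⟨G, K, ?_, .inr ?_⟩
    · rw [hr, pa3, pa4]; exact hT
    · rw [hr, pa4]; exact hg.stuck hc
  · obtain ⟨hb, hb1, G', hT'⟩ := hT.step hd hg hc hB
    have hm0 := hg.pos
    rw [pa3, p5] at hr3
    rw [pa4, p5, pa2] at hr4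
    refine ⟨G', K + 1, ?_, ?_⟩
    · rw [hr3, hr4]; exact hT'
    · rw [hr4]
      exact hK.imp (congrArg (· + 1)) fun h => h.update hb hb1 (by omega)

theorem greedy_spec (σ : State) (hn : 0 < σ.reg 0) (hlr : ∀ s < σ.reg 0, σ.arr 0 s < σ.arr 1 s)
    (hd : ∀ s < σ.reg 0, 0 < σ.arr 2 s) (h3 : ∀ s < σ.reg 0, σ.arr 3 s = 0) :
    ∃ e G K, Tracks (σ.arr 0) (σ.arr 1) (σ.arr 2) (σ.reg 0) e ((greedy.run σ).arr 3) G K ∧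
      Stuck (σ.arr 0) (σ.arr 1) e (σ.reg 0) := by
  let init : ForProg := forN 3 (store 4 (var 3) (lit 1))
  set τ := init.run σ with hτ
  have t0 : τ.reg 0 = σ.reg 0 := reg_run (by decide) σ
  have ta0 : τ.arr 0 = σ.arr 0 := arr_run (by decide) σ
  have ta1 : τ.arr 1 = σ.arr 1 := arr_run (by decide) σ
  have ta2 : τ.arr 2 = σ.arr 2 := arr_run (by decide) σ
  have ta3 : τ.arr 3 = σ.arr 3 := arr_run (by decide) σ
  have ta4 : ∀ s < σ.reg 0, τ.arr 4 s = 1 := by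
    refine forN_induction (p := store 4 (var 3) (lit 1)) (σ := σ) (c := 3)
      (fun k υ => ∀ s < k, υ.arr 4 s = 1) (by decide) (fun s hs => absurd hs (Nat.not_lt_zero s))
      fun k υ hk hc hr ha h s hs => ?_
    simp only [run_store, arr_setReg, State.setArr, val, hc, Function.update_self]
    rcases Nat.lt_succ_iff_lt_or_eq.1 hs with hs | rfl
    · rw [Function.update_of_ne hs.ne]; exact h s hs
    · exact Function.update_self ..
  have hinv : Inv σ (τ.reg 0) ((forN 10 greedyBody).run τ) := by
    refine forN_induction (p := greedyBody) (σ := τ) (c := 10) (Inv σ) (by decide) ?_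
      fun k υ hk hc hr ha h => ?_
    · exact ⟨_, 0, tracks_init.congr ta4 (fun s hs => by
        rw [arr_setReg, ta3]; exact h3 s hs), .inl rfl⟩
    · exact h.step hn hlr hd ((hr 0 (by decide) (by decide)).trans t0)
        ((ha 0 (by decide)).trans ta0) ((ha 1 (by decide)).trans ta1)
        ((ha 2 (by decide)).trans ta2)
  obtain ⟨G, K, hT, hK⟩ := hinv
  refine ⟨_, G, K, hT, ?_⟩
  rcases hK with rfl | hK
  · rw [t0] at hT
    exact hT.stuck hd hn hlr
  · exact hK

end RAM.ForProg

/-! ### Real schedules, the load bound and the size of the input. -/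

namespace RSC

open RAM

variable {n : ℕ}

theorem le_inputSize (S : Fin n → Sensor) : n ≤ inputSize S := by
  calc n = ∑ _i : Fin n, 1 := by simp
    -- Each duration is positive and so has at least one binary digit.
    _ ≤ inputSize S := Finset.sum_le_sum fun i _ => by
      have := Nat.size_pos.2 (S i).dur_pos
      omega

theorem eval_mono (P : Polynomial ℕ) {a b : ℕ} (h : a ≤ b) : P.eval a ≤ P.eval b := by
  rw [Polynomial.eval_eq_sum, Polynomial.eval_eq_sum]
  exact Finset.sum_le_sum fun i _ => Nat.mul_le_mul le_rfl (Nat.pow_le_pow_left h i)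

theorem greedy_exec (S : Fin n → Sensor) :
    ∃ k ≤ ForProg.greedy.cost.eval n,
      Exec ForProg.greedy.compile (inputState S) k (ForProg.greedy.run (inputState S)) :=
  ForProg.exec_compile (σ := inputState S)
    (by simp [ForProg.greedy, ForProg.greedyBody, ForProg.findMin, ForProg.findNext,
      ForProg.findMinBody, ForProg.findNextBody, ForProg.considerMin, ForProg.considerNext, ForProg.levelProg,
      ForProg.choose, ForProg.select, ForProg.schedule, ForProg.WF, ForProg.regs])
    (by decide)

theorem mem_region_iff {s : Sensor} {x : ℝ} (hx : 0 ≤ x) :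
    x ∈ s.region ↔ s.left ≤ ⌊x⌋₊ ∧ ⌊x⌋₊ < s.right := by
  rw [Sensor.region, Set.mem_Ico, Nat.le_floor_iff hx, Nat.floor_lt hx]

theorem load_le_loadAt {S : Fin n → Sensor} {x : ℝ} (hx : x ∈ region S) : load S ≤ loadAt S x :=
  Nat.sInf_le ⟨x, hx, rfl⟩

/-- No schedule lasts longer than the load at any point. -/
theorem IsSchedule.le_loadAt {S : Fin n → Sensor} {t : Fin n → ℝ} {T : ℝ} (h : IsSchedule S t T)
    {x : ℝ} (hx : x ∈ region S) : T ≤ loadAt S x := by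
  classical
  let A := Finset.univ.filter fun i => x ∈ (S i).region
  -- The activity intervals of the sensors live at `x` cover `[0, T)`, so their total length is at
  -- least `T`.
  have hsub : Set.Ico 0 T ⊆ ⋃ i ∈ A, Set.Ico (t i) (t i + (S i).dur) := by
    intro y hy
    obtain ⟨i, hi, h1, h2⟩ := h.covers x hx y hy.1 hy.2
    exact Set.mem_biUnion (show i ∈ A from Finset.mem_filter.2 ⟨Finset.mem_univ i, hi⟩) ⟨h1, h2⟩
  have hvol := (MeasureTheory.measure_mono hsub).trans
    (MeasureTheory.measure_biUnion_finset_le (μ := MeasureTheory.volume) A _)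
  simp only [Real.volume_Ico, sub_zero, add_sub_cancel_left, ENNReal.ofReal_natCast] at hvol
  rw [← Nat.cast_sum, ← ENNReal.ofReal_natCast,
    ENNReal.ofReal_le_ofReal_iff (Nat.cast_nonneg _)] at hvol
  refine hvol.trans (le_of_eq ?_)
  rw [loadAt]

/-- The schedule of the greedy algorithm lasts for at least one seventh of the load at some
point. -/
theorem exists_loadAt_le (hn : 0 < n) (S : Fin n → Sensor) :
    ∃ T : ℝ, IsSchedule S (output n (ForProg.greedy.run (inputState S))) T ∧
      ∃ x ∈ region S, (loadAt S x : ℝ) ≤ 7 * T := by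
  classical
  have a0 : ∀ i : Fin n, (inputState S).arr 0 i = (S i).left := fun i => by simp [inputState]
  have a1 : ∀ i : Fin n, (inputState S).arr 1 i = (S i).right := fun i => by simp [inputState]
  have a2 : ∀ i : Fin n, (inputState S).arr 2 i = (S i).dur := fun i => by simp [inputState]
  obtain ⟨e, G, K, hT, x, hx0, hmin, hs⟩ := ForProg.greedy_spec (inputState S) hn
    (fun s hs => by rw [a0 ⟨s, hs⟩, a1 ⟨s, hs⟩]; exact (S ⟨s, hs⟩).left_lt_right)
    (fun s hs => by rw [a2 ⟨s, hs⟩]; exact (S ⟨s, hs⟩).dur_pos)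
    (fun s hs => by simp [inputState])
  have hreg : (inputState S).reg 0 = n := rfl
  rw [hreg] at hT hx0 hmin hs
  have hload := hT.load_le hs
  set L := level ((inputState S).arr 0) ((inputState S).arr 1) e n with hL
  refine ⟨((L x - 1 : ℕ) : ℝ), ⟨fun i => Nat.cast_nonneg _, Nat.cast_nonneg _, ?_⟩, x, ?_, ?_⟩
  · intro z hz y hy hyT
    obtain ⟨i, hi⟩ := Set.mem_iUnion.1 hz
    have hz0 : 0 ≤ z := (Nat.cast_nonneg _).trans hi.1
    rw [mem_region_iff hz0, ← a0, ← a1] at hi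
    -- Endpoints and stored times are integers, so real points and times can be rounded down; the
    -- level at `⌊z⌋₊` is positive because `z` lies in `U`.
    have h1 := hmin ⌊z⌋₊ (by
      have : e i ≤ L ⌊z⌋₊ := le_level i.2 hi.1 hi.2
      have := hT.ne_zero i.2
      omega)
    change L x ≤ L ⌊z⌋₊ at h1
    have h2 : ⌊y⌋₊ < L x - 1 := (Nat.floor_lt hy).2 hyT
    obtain ⟨s, hsn, -, h3, h4, h5, h6⟩ := hT.covered ⌊z⌋₊ ⌊y⌋₊ (by
      change _ < L ⌊z⌋₊; omega)
    refine ⟨⟨s, hsn⟩, ?_, ?_, ?_⟩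
    · rw [mem_region_iff hz0, ← a0, ← a1]; exact ⟨h3, h4⟩
    · exact (Nat.le_floor_iff hy).1 h5
    · rw [← a2]
      have := (Nat.floor_lt hy).1 h6
      push_cast at this
      exact this
  · obtain ⟨s, hsn, h1, h2, -⟩ := exists_eq_level hx0
    refine Set.mem_iUnion.2 ⟨⟨s, hsn⟩, ?_⟩
    rw [mem_region_iff (Nat.cast_nonneg x), Nat.floor_natCast, ← a0, ← a1]
    exact ⟨h1, h2⟩
  · rw [Finset.sum_filter, Finset.sum_range] at hload
    have : loadAt S x ≤ 7 * (L x - 1) := by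
      refine le_of_eq_of_le ?_ hload
      rw [loadAt, Finset.sum_filter]
      refine Finset.sum_congr rfl fun i _ => ?_
      simp only [mem_region_iff (Nat.cast_nonneg (α := ℝ) x), Nat.floor_natCast, a0, a1, a2]
    exact_mod_cast this

end RSC

/-- There is a polynomial-time `O(log log n)`-approximation algorithm for Restricted Strip
Cover. -/
theorem mainTheorem1 :
    ∃ (p : RAM.Prog) (ρ : ℕ → ℝ),
      RSC.RunsInPolyTime p ∧
      RSC.Approximates p ρ ∧
      ρ =O[atTop] (fun n : ℕ => Real.log (Real.log (n : ℝ))) := by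
  refine ⟨RAM.ForProg.greedy.compile, fun _ => 7, ?_, ?_, ?_⟩
  · refine ⟨RAM.ForProg.greedy.cost, fun n _ S => ?_⟩
    obtain ⟨k, hk, h⟩ := RSC.greedy_exec S
    exact ⟨k, _, h, hk.trans (RSC.eval_mono _ (RSC.le_inputSize S))⟩
  · intro n hn S k τ h
    obtain ⟨k', -, h'⟩ := RSC.greedy_exec S
    rw [h.state_unique h']
    obtain ⟨T, hT, x, hx, hle⟩ := RSC.exists_loadAt_le hn S
    exact ⟨T, hT, (Nat.cast_le.2 (RSC.load_le_loadAt hx)).trans hle,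
      fun t' T' hS => (hS.le_loadAt hx).trans hle⟩
  · have htop : Tendsto (fun n : ℕ => Real.log (Real.log (n : ℝ))) atTop atTop :=
      Real.tendsto_log_atTop.comp (Real.tendsto_log_atTop.comp tendsto_natCast_atTop_atTop)
    exact (isLittleO_const_left.2 (.inr (tendsto_norm_atTop_atTop.comp htop))).isBigO
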